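/- Let $\mathcal T=\mathbb R/2\pi\mathbb Z$ and let $\mu$ be any Borel probability measure on $\mathcal T$ with $\int_{\mathcal T}e^{i\theta}\,d\mu(\theta)=0$ (no smoothness is assumed). Let $F_\mu(x)=\mu([0,x])$ and $F_\mu^{-1}(y)=\inf\{x\ge 0: F_\mu(x)\ge y\}$, where $[0,x]$ is read in $\mathcal T$, and let $\mathcal B_\mu$ be the range of $$Z_\mu:[0,1]\to\mathbb C,\qquad Z_\mu(t)=\int_0^t e^{iF_\mu^{-1}(u)}\,du .$$ For $k\ge 0$ set $a_k(\mu)=\frac1\pi\int\cos(k\theta)\,d\mu(\theta)$ and $b_k(\mu)=\frac1\pi\int\sin(k\theta)\,d\mu(\theta)$. Let $\mathrm{Conv}(1)$ be the set of compact convex subsets of $\mathbb C$ that contain $0$, lie in $\{\operatorname{Im} z\ge 0\}$, meet the real axis only in $[0,\infty)$ and have perimeter $1$, where the perimeter is the length of the boundary if the interior is non-empty, and twice the length for a segment; the boundary of a set with empty interior (a segment) is the set itself. Then there is exactly one $\mathcal C_\mu\in\mathrm{Conv}(1)$ whose boundary is $\mathcal B_\mu$, the series below converges, and the area of $\mathcal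 C_\mu$ is $$\mathcal A(\mu)=\frac1{4\pi}-\frac{\pi}{2}\sum_{k\ge 2}\frac{a_k(\mu)^2+b_k(\mu)^2}{k^2-1}.$$ -/

import Mathlib

open MeasureTheory Set

noncomputable section

namespace GaussMinkowski

/-- The circle `𝒯 = ℝ / 2πℤ`. -/
abbrev T : Type := AddCircle (2 * Real.pi)

/-- `X_μ` has mean zero in the plane: `∫ exp(iθ) dμ(θ) = 0`. Together with `IsProbabilityMeasure μ`
this says that `μ` belongs to `M_T^0`. -/
def MeanZero (μ : Measure T) : Prop :=
  ∫ θ, (AddCircle.toCircle θ : ℂ) ∂μ = 0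

/-- Fourier coefficient `a_k(μ) = (1/π) E(cos(k X_μ))`. -/
def a (μ : Measure T) (k : ℕ) : ℝ :=
  1 / Real.pi * ∫ θ, Real.cos_periodic.lift (k • θ) ∂μ

/-- Fourier coefficient `b_k(μ) = (1/π) E(sin(k X_μ))`. -/
def b (μ : Measure T) (k : ℕ) : ℝ :=
  1 / Real.pi * ∫ θ, Real.sin_periodic.lift (k • θ) ∂μ

/-- The distribution function `F_μ(x) = μ([0,x])`, where `[0,x]` is read in the circle
(so `F_μ` is constant equal to `1` on `[2π, ∞)`). -/
def cdf (μ : Measure T) (x : ℝ) : ℝ :=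
  μ.real ((fun s : ℝ => (s : T)) '' Icc 0 x)

/-- The standard generalised inverse `F_μ⁻¹(y) = inf {x ≥ 0 : F_μ(x) ≥ y}`. -/
def cdfInv (μ : Measure T) (y : ℝ) : ℝ :=
  sInf {x : ℝ | 0 ≤ x ∧ y ≤ cdf μ x}

/-- The curve `Z_μ(t) = ∫_0^t exp(i F_μ⁻¹(u)) du`. -/
def Z (μ : Measure T) (t : ℝ) : ℂ :=
  ∫ u in (0 : ℝ)..t, Complex.exp (Complex.I * (cdfInv μ u : ℂ))

/-- The range `B_μ` of `Z_μ` on `[0,1]`. -/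
def curve (μ : Measure T) : Set ℂ :=
  Z μ '' Icc 0 1

/-- The boundary of a compact convex set of the plane: `C` minus its interior if the interior is
non-empty; a set with empty interior (a segment) is its own boundary. -/
def boundary (C : Set ℂ) : Set ℂ :=
  {z ∈ C | (interior C).Nonempty → z ∉ interior C}

/-- `γ` is a natural (arc length) parametrisation on `[0, L]` of the closed simple curve `B`. -/
structure IsNaturalParam (γ : ℝ → ℂ) (L : ℝ) (B : Set ℂ) : Prop where
  continuousOn : ContinuousOn γ (Icc 0 L)
  injOn : InjOn γ (Ico 0 L)
  closed : γ 0 = γ L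
  image_eq : γ '' Icc 0 L = B
  unitSpeed : HasUnitSpeedOn γ (Icc 0 L)

/-- The compact convex set `C` has perimeter `L`: the length of its boundary curve if the interior
is non-empty, and twice the length for a segment. -/
def HasPerimeter (C : Set ℂ) (L : ℝ) : Prop :=
  ((interior C).Nonempty ∧ 0 < L ∧ ∃ γ : ℝ → ℂ, IsNaturalParam γ L (boundary C)) ∨
    ∃ p q : ℂ, C = segment ℝ p q ∧ L = 2 * dist p q

/-- The set `Conv(1)`: compact convex sets of the plane that contain the origin, lie above the
`x`-axis, meet the `x`-axis only in `ℝ⁺`, and have perimeter `1`. -/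
structure MemConvOne (C : Set ℂ) : Prop where
  isCompact : IsCompact C
  convex : Convex ℝ C
  zero_mem : (0 : ℂ) ∈ C
  im_nonneg : ∀ z ∈ C, 0 ≤ z.im
  re_nonneg : ∀ z ∈ C, z.im = 0 → 0 ≤ z.re
  perimeter : HasPerimeter C 1

/-- `C` is the convex set `C_μ` associated with `μ`: the element of `Conv(1)` with
boundary `B_μ`. -/
def IsConvexSetOf (μ : Measure T) (C : Set ℂ) : Prop :=
  MemConvOne C ∧ boundary C = curve μ

end GaussMinkowski

end

/-! The quantile function of `μ`, extended to the line by `Θ (u + 1) = Θ u + 2π`, is the tangent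
angle of the curve as a function of arc length. It is monotone, and the mean-zero condition says
exactly that the curve closes up. All the geometry follows from these properties (`IsTurning`).

Convexity: along the curve, the height above the tangent line of direction `α` has derivative `sin
(Θ - α)`, which is nonnegative until the tangent has turned by `π` and nonpositive during the rest
of the period, while its total over a period is zero. So the height is never negative
(`height_path_le`), and it vanishes only along a straight edge unless the whole curve lies in a line
(`eq_of_height_eq`). Every tangent line thus supports the convex hull, and outside the flat case it
meets the hull in an edge of the curve; with Hahn–Banach the boundary of the hull is the curve
(`boundary_region`). Uniqueness holds because a compact convex set is the hull of its boundary.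

Area: horizontal slices give the area as the integral of `x dy` (`volume_region`). Monotonicity of
`Θ` turns this into `4 A = E sin |Θ - Θ'|` for two independent uniform parameters. Closedness makes
`E (Θ - Θ') sin (Θ - Θ')` vanish, so `sin |x|` may be replaced by `green |x| = sin |x| - x sin x /
π`, which on `[-2π, 2π]` depends on `x` modulo `2π` only. Its cosine series has constant term `1/π`
and coefficients `-(2/π)/(k² - 1)` for `k ≥ 2`; the mode `k = 1` has mean zero by closedness. Since
`Θ` at a uniform parameter has the law of `μ` (`map_turning`), `E cos k(Θ - Θ') = π² (a_k² + b_k²)`,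
and termwise integration gives the formula. -/

noncomputable section

/-! ### Closed curves with monotone tangent angle, and their tangent lines -/

namespace GaussMinkowski

/-- `Θ` is the tangent angle of a closed convex curve of length `1`, as a function of arc length. -/
structure IsTurning (Θ : ℝ → ℝ) : Prop where
  mono : Monotone Θ
  add_one : ∀ u, Θ (u + 1) = Θ u + 2 * Real.pi
  closed : ∫ u in (0 : ℝ)..1, Complex.exp (Complex.I * (Θ u : ℂ)) = 0

/-- The curve with tangent angle `Θ` that starts at the origin. -/
def path (Θ : ℝ → ℝ) (t : ℝ) : ℂ :=
  ∫ u in (0 : ℝ)..t, Complex.exp (Complex.I * (Θ u : ℂ))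

/-- The height of a point above the line through the origin with direction `exp (iα)`. -/
def height (α : ℝ) : ℂ →L[ℝ] ℝ :=
  Real.cos α • Complex.imCLM - Real.sin α • Complex.reCLM

lemma height_apply (α : ℝ) (z : ℂ) :
    height α z = Real.cos α * z.im - Real.sin α * z.re := rfl

/-- `Θ` crosses the value `α` at `t`. -/
structure IsCrossing (Θ : ℝ → ℝ) (α t : ℝ) : Prop where
  le_of_lt : ∀ u, u < t → Θ u ≤ α
  le_of_gt : ∀ u, t < u → α ≤ Θ u

lemma exp_I_mul (x : ℝ) :
    Complex.exp (Complex.I * (x : ℂ)) = ⟨Real.cos x, Real.sin x⟩ := by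
  rw [mul_comm, Complex.exp_mul_I]
  apply Complex.ext <;> simp [← Complex.ofReal_cos, ← Complex.ofReal_sin]

lemma height_exp (α x : ℝ) :
    height α (Complex.exp (Complex.I * (x : ℂ))) = Real.sin (x - α) := by
  rw [exp_I_mul, height_apply, Real.sin_sub]; ring

lemma norm_exp_I_mul (x : ℝ) : ‖Complex.exp (Complex.I * (x : ℂ))‖ = 1 := by
  rw [mul_comm, Complex.norm_exp_ofReal_mul_I]

/-- Every nonzero real functional of the plane is a positive multiple of a height. -/
lemma exists_eq_height (f : ℂ →L[ℝ] ℝ) (hf : f ≠ 0) :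
    ∃ r > 0, ∃ α : ℝ, ∀ z, f z = r * height α z := by
  set w : ℂ := ⟨f Complex.I, - f 1⟩ with hw
  have hz : ∀ z : ℂ, f z = z.re * f 1 + z.im * f Complex.I := by
    intro z
    have h : z = z.re • (1 : ℂ) + z.im • Complex.I := by
      apply Complex.ext <;> simp
    calc f z = f (z.re • (1 : ℂ) + z.im • Complex.I) := by rw [← h]
      _ = _ := by rw [map_add, map_smul, map_smul, smul_eq_mul, smul_eq_mul]
  have hw0 : w ≠ 0 := by
    intro h
    apply hf
    ext z
    have h1 : f Complex.I = 0 := congrArg Complex.re h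
    have h2 : - f 1 = 0 := congrArg Complex.im h
    rw [hz, h1, neg_eq_zero.1 h2]; simp
  refine ⟨‖w‖, norm_pos_iff.2 hw0, w.arg, fun z => ?_⟩
  have h1 : ‖w‖ * Real.cos w.arg = f Complex.I := Complex.norm_mul_cos_arg w
  have h2 : ‖w‖ * Real.sin w.arg = - f 1 := Complex.norm_mul_sin_arg w
  rw [height_apply, hz]
  linear_combination (-z.im) * h1 + z.re * h2

namespace IsTurning

variable {Θ : ℝ → ℝ}

lemma add_int (hΘ : IsTurning Θ) (u : ℝ) (n : ℤ) : Θ (u + n) = Θ u + 2 * Real.pi * n := by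
  induction n using Int.induction_on with
  | zero => simp
  | succ n ih =>
    have := hΘ.add_one (u + n)
    push_cast at ih ⊢
    rw [← add_assoc, this, ih]; ring
  | pred n ih =>
    have := hΘ.add_one (u + (-n - 1))
    push_cast at ih ⊢
    rw [show u + (-(n : ℝ) - 1) + 1 = u + -n by ring, ih] at this
    linarith

lemma sub_one (hΘ : IsTurning Θ) (u : ℝ) : Θ (u - 1) = Θ u - 2 * Real.pi := by
  have := hΘ.add_one (u - 1)
  rw [sub_add_cancel] at this; linarith

lemma measurable_exp (hΘ : IsTurning Θ) :
    Measurable fun u => Complex.exp (Complex.I * (Θ u : ℂ)) := by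
  have := hΘ.mono.measurable
  fun_prop

lemma intervalIntegrable_exp (hΘ : IsTurning Θ) (a b : ℝ) :
    IntervalIntegrable (fun u => Complex.exp (Complex.I * (Θ u : ℂ))) volume a b := by
  apply (intervalIntegrable_const (c := (1 : ℝ))).mono_fun
  · exact hΘ.measurable_exp.aestronglyMeasurable
  · filter_upwards with u
    rw [norm_exp_I_mul]; simp

lemma periodic_exp (hΘ : IsTurning Θ) :
    Function.Periodic (fun u => Complex.exp (Complex.I * (Θ u : ℂ))) 1 := by
  intro u
  simp only [hΘ.add_one]
  rw [exp_I_mul, exp_I_mul, Real.cos_add_two_pi, Real.sin_add_two_pi]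

lemma path_sub_path (hΘ : IsTurning Θ) (s t : ℝ) :
    path Θ s - path Θ t = ∫ u in t..s, Complex.exp (Complex.I * (Θ u : ℂ)) :=
  intervalIntegral.integral_interval_sub_left (hΘ.intervalIntegrable_exp _ _)
    (hΘ.intervalIntegrable_exp _ _)

lemma path_zero : path Θ 0 = 0 := by simp [path]

lemma path_add_one (hΘ : IsTurning Θ) (t : ℝ) : path Θ (t + 1) = path Θ t := by
  rw [← sub_eq_zero, hΘ.path_sub_path, hΘ.periodic_exp.intervalIntegral_add_eq t 0, zero_add,
    hΘ.closed]

lemma path_periodic (hΘ : IsTurning Θ) : Function.Periodic (path Θ) 1 := hΘ.path_add_one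

lemma norm_path_sub_le (hΘ : IsTurning Θ) (s t : ℝ) : ‖path Θ s - path Θ t‖ ≤ |s - t| := by
  rw [hΘ.path_sub_path, ← one_mul |s - t|]
  apply intervalIntegral.norm_integral_le_of_norm_le_const
  intro u _
  rw [norm_exp_I_mul]

lemma lipschitz_path (hΘ : IsTurning Θ) : LipschitzWith 1 (path Θ) := by
  apply LipschitzWith.of_dist_le_mul
  intro s t
  rw [dist_eq_norm, Real.dist_eq]
  simpa using hΘ.norm_path_sub_le s t

lemma continuous_path (hΘ : IsTurning Θ) : Continuous (path Θ) := hΘ.lipschitz_path.continuous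

lemma intervalIntegrable_sin (hΘ : IsTurning Θ) (α a b : ℝ) :
    IntervalIntegrable (fun u => Real.sin (Θ u - α)) volume a b := by
  apply (intervalIntegrable_const (c := (1 : ℝ))).mono_fun
  · have := hΘ.mono.measurable
    exact (by fun_prop : Measurable fun u => Real.sin (Θ u - α)).aestronglyMeasurable
  · filter_upwards with u
    simpa using Real.abs_sin_le_one _

lemma height_sub (hΘ : IsTurning Θ) (α s t : ℝ) :
    height α (path Θ s) - height α (path Θ t) = ∫ u in t..s, Real.sin (Θ u - α) := by
  rw [← map_sub, hΘ.path_sub_path,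
    ← ContinuousLinearMap.intervalIntegral_comp_comm _ (hΘ.intervalIntegrable_exp _ _)]
  simp_rw [height_exp]

lemma path_eq_add_of_const (hΘ : IsTurning Θ) {α s t : ℝ} (hts : t ≤ s)
    (h : ∀ u ∈ Ioo t s, Θ u = α) :
    path Θ s = path Θ t + ((s - t : ℝ) : ℂ) * Complex.exp (Complex.I * (α : ℂ)) := by
  rw [← sub_eq_iff_eq_add', hΘ.path_sub_path,
    intervalIntegral.integral_congr_Ioo_of_le hts (g := fun _ => Complex.exp (Complex.I * (α : ℂ)))
      (fun u hu => by simp only [h u hu])]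
  simp

/-- Quasi-periodicity makes `Θ` unbounded in both directions, so the infimum of `{u | α ≤ Θ u}`
exists and is a crossing. Strictness on the left makes it the first one, so that a flat curve starts
there from an end of its segment. -/
lemma exists_crossing (hΘ : IsTurning Θ) (α : ℝ) :
    ∃ t, (∀ u, u < t → Θ u < α) ∧ ∀ u, t < u → α ≤ Θ u := by
  have hpi := Real.pi_pos
  have hb : ∃ b, Θ b < α := by
    obtain ⟨n, hn⟩ := exists_int_lt ((α - Θ 0) / (2 * Real.pi))
    refine ⟨(0 : ℝ) + n, ?_⟩
    rw [hΘ.add_int]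
    rw [lt_div_iff₀ (by positivity)] at hn
    linarith
  have hne : ∃ a, α ≤ Θ a := by
    obtain ⟨n, hn⟩ := exists_int_gt ((α - Θ 0) / (2 * Real.pi))
    refine ⟨(0 : ℝ) + n, ?_⟩
    rw [hΘ.add_int]
    rw [div_lt_iff₀ (by positivity)] at hn
    linarith
  obtain ⟨b, hb⟩ := hb
  have hbdd : BddBelow {u | α ≤ Θ u} := ⟨b, fun u hu => by
    by_contra hlt
    exact absurd (hΘ.mono (not_le.1 hlt).le) (not_le.2 (hb.trans_le hu))⟩
  refine ⟨sInf {u | α ≤ Θ u}, fun u hu => ?_, fun u hu => ?_⟩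
  · by_contra hlt
    exact absurd (csInf_le hbdd (not_lt.1 hlt)) (not_le.2 hu)
  · obtain ⟨v, hv, hvu⟩ := exists_lt_of_csInf_lt hne hu
    exact le_trans hv (hΘ.mono hvu.le)

lemma isCrossing_self (hΘ : IsTurning Θ) (t : ℝ) : IsCrossing Θ (Θ t) t :=
  ⟨fun _ hu => hΘ.mono hu.le, fun _ hu => hΘ.mono hu.le⟩

lemma le_add_two_pi (hΘ : IsTurning Θ) {α t : ℝ} (h : IsCrossing Θ α t) {u : ℝ} (hu : u < t + 1) :
    Θ u ≤ α + 2 * Real.pi := by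
  have := h.le_of_lt (u - 1) (by linarith)
  rw [hΘ.sub_one] at this
  linarith

/-- The curve is back at its starting point at `t + 1`, so heights can also be measured along the
remaining part of the loop. -/
lemma height_sub_eq_neg (hΘ : IsTurning Θ) (α s t : ℝ) :
    height α (path Θ s) - height α (path Θ t) = - ∫ u in s..(t + 1), Real.sin (Θ u - α) := by
  rw [← hΘ.height_sub, hΘ.path_add_one]; ring

lemma sin_nonpos_of {x α : ℝ} (h1 : α + Real.pi ≤ x) (h2 : x ≤ α + 2 * Real.pi) :
    Real.sin (x - α) ≤ 0 := by
  rw [← Real.sin_sub_two_pi]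
  exact Real.sin_nonpos_of_nonpos_of_neg_pi_le (by linarith) (by linarith)

lemma sin_neg_of {x α : ℝ} (h1 : α + Real.pi < x) (h2 : x < α + 2 * Real.pi) :
    Real.sin (x - α) < 0 := by
  rw [← Real.sin_sub_two_pi]
  exact Real.sin_neg_of_neg_of_neg_pi_lt (by linarith) (by linarith)

lemma integral_nonneg_of_Ioo {f : ℝ → ℝ} {a b : ℝ} (hab : a ≤ b) (h : ∀ u ∈ Ioo a b, 0 ≤ f u) :
    0 ≤ ∫ u in a..b, f u := by
  rw [intervalIntegral.integral_of_le hab, integral_Ioc_eq_integral_Ioo]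
  exact setIntegral_nonneg measurableSet_Ioo h

lemma integral_nonpos_of_Ioo {f : ℝ → ℝ} {a b : ℝ} (hab : a ≤ b) (h : ∀ u ∈ Ioo a b, f u ≤ 0) :
    ∫ u in a..b, f u ≤ 0 := by
  rw [intervalIntegral.integral_of_le hab, integral_Ioc_eq_integral_Ioo]
  exact setIntegral_nonpos measurableSet_Ioo h

lemma integral_neg_of_Ioo {f : ℝ → ℝ} {a b : ℝ} (hab : a < b)
    (hf : IntervalIntegrable f volume a b) (h : ∀ u ∈ Ioo a b, f u < 0) :
    ∫ u in a..b, f u < 0 := by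
  have := intervalIntegral.intervalIntegral_pos_of_pos_on hf.neg
    (fun u hu => by simpa using h u hu) hab
  simp only [Pi.neg_apply, intervalIntegral.integral_neg] at this
  linarith

lemma exists_mem_Ico_path_eq (hΘ : IsTurning Θ) (t s : ℝ) :
    ∃ s' ∈ Ico t (t + 1), path Θ s = path Θ s' :=
  hΘ.path_periodic.exists_mem_Ico one_pos s t

/-- The curve lies on one side of each of its tangent lines. -/
theorem height_path_le (hΘ : IsTurning Θ) {α t : ℝ} (h : IsCrossing Θ α t) (s : ℝ) :
    height α (path Θ t) ≤ height α (path Θ s) := by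
  obtain ⟨s', hs', he⟩ := hΘ.exists_mem_Ico_path_eq t s
  rw [he, ← sub_nonneg]
  -- If the tangent has not yet turned by more than `π`, the integrand from `t` is nonnegative.
  -- Otherwise it is nonpositive from `s'` to `t + 1`, where the height takes its initial value
  -- again.
  by_cases hc : ∀ u ∈ Ioo t s', Θ u ≤ α + Real.pi
  · rw [hΘ.height_sub]
    refine integral_nonneg_of_Ioo hs'.1 fun u hu => ?_
    have h1 := h.le_of_gt u hu.1
    have h2 := hc u hu
    exact Real.sin_nonneg_of_nonneg_of_le_pi (by linarith) (by linarith)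
  · push Not at hc
    obtain ⟨u₀, hu₀, h0⟩ := hc
    rw [hΘ.height_sub_eq_neg, neg_nonneg]
    refine integral_nonpos_of_Ioo hs'.2.le fun u hu => ?_
    have h1 := hΘ.mono (hu₀.2.trans hu.1).le
    exact sin_nonpos_of (by linarith) (hΘ.le_add_two_pi h hu.2)

/-- A curve that touches its tangent line in direction `α` at the parameters `t` and `s` is
straight between them, or lies on the line. -/
theorem eq_of_height_eq (hΘ : IsTurning Θ) {α t s : ℝ} (h : IsCrossing Θ α t)
    (he : height α (path Θ s) = height α (path Θ t)) :
    (∀ u ∈ Ioo t s, Θ u = α) ∨ (∀ u ∈ Ioo s (t + 1), Θ u = α + 2 * Real.pi) ∨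
      ∀ x, height α (path Θ x) = height α (path Θ t) := by
  have hpi := Real.pi_pos
  by_cases hc : ∀ u ∈ Ioo t s, Θ u ≤ α + Real.pi
  · by_cases h1 : ∀ u ∈ Ioo t s, Θ u = α
    · exact Or.inl h1
    · right; right
      push Not at h1
      obtain ⟨v, hv, hva⟩ := h1
      have hva' : α < Θ v := lt_of_le_of_ne (h.le_of_gt v hv.1) hva.symm
      have hsin : ∀ u ∈ Ioo t s, 0 ≤ Real.sin (Θ u - α) := fun u hu =>
        Real.sin_nonneg_of_nonneg_of_le_pi (by linarith [h.le_of_gt u hu.1])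
          (by linarith [hc u hu])
      -- The nonnegative integrand has integral zero over `(t, s)`, so past `v` the sine must
      -- vanish. As `Θ` already exceeds `α` there, only the value `α + π` is left.
      have hvs : ∀ u ∈ Ioo v s, Θ u = α + Real.pi := by
        intro u hu
        by_contra hne
        have hlt : Θ u < α + Real.pi := lt_of_le_of_ne (hc u ⟨hv.1.trans hu.1, hu.2⟩) hne
        have hpos : 0 < ∫ x in v..u, Real.sin (Θ x - α) := by
          refine intervalIntegral.intervalIntegral_pos_of_pos_on
            (hΘ.intervalIntegrable_sin _ _ _) (fun x hx => ?_) hu.1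
          have h2 := hΘ.mono hx.1.le
          have h3 := hΘ.mono hx.2.le
          exact Real.sin_pos_of_pos_of_lt_pi (by linarith) (by linarith)
        have ha : 0 ≤ ∫ x in t..v, Real.sin (Θ x - α) :=
          integral_nonneg_of_Ioo hv.1.le fun x hx => hsin x ⟨hx.1, hx.2.trans hv.2⟩
        have hb : 0 ≤ ∫ x in u..s, Real.sin (Θ x - α) :=
          integral_nonneg_of_Ioo hu.2.le fun x hx => hsin x ⟨(hv.1.trans hu.1).trans hx.1, hx.2⟩
        rw [← hΘ.height_sub] at hpos ha hb
        linarith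
      obtain ⟨w, hw⟩ := exists_between hv.2
      have hws := hvs w hw
      intro x
      obtain ⟨x', hx', hxe⟩ := hΘ.exists_mem_Ico_path_eq t x
      rw [hxe]
      -- The direction `α + π` is reached before `s`, so the height is nondecreasing up to `s` and
      -- nonincreasing after it: its maximum is at `s`, where it equals its minimum.
      refine le_antisymm ?_ (hΘ.height_path_le h x')
      rw [← he]
      rcases le_total x' s with hxs | hxs
      · rw [← sub_nonneg, hΘ.height_sub]
        exact integral_nonneg_of_Ioo hxs fun u hu => hsin u ⟨hx'.1.trans_lt hu.1, hu.2⟩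
      · rw [← sub_nonpos, hΘ.height_sub]
        refine integral_nonpos_of_Ioo hxs fun u hu => ?_
        have h2 := hΘ.mono (hw.2.trans hu.1).le
        exact sin_nonpos_of (by linarith) (hΘ.le_add_two_pi h (hu.2.trans hx'.2))
  · push Not at hc
    obtain ⟨u₀, hu₀, h0⟩ := hc
    right; left
    intro u hu
    by_contra hne
    have hlt : Θ u < α + 2 * Real.pi := lt_of_le_of_ne (hΘ.le_add_two_pi h hu.2) hne
    have hneg : ∫ x in s..u, Real.sin (Θ x - α) < 0 := by
      refine integral_neg_of_Ioo hu.1 (hΘ.intervalIntegrable_sin _ _ _) fun x hx => ?_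
      have h2 := hΘ.mono (hu₀.2.trans hx.1).le
      have h3 := hΘ.mono hx.2.le
      exact sin_neg_of (by linarith) (by linarith)
    rw [← hΘ.height_sub] at hneg
    linarith [hΘ.height_path_le h u]

/-- A curve contained in a line is a segment of length `1 / 2`, traversed twice. -/
theorem image_eq_segment_of_height_const (hΘ : IsTurning Θ) {α t : ℝ}
    (hlt : ∀ u, u < t → Θ u < α) (hge : ∀ u, t < u → α ≤ Θ u)
    (hc : ∀ x, height α (path Θ x) = height α (path Θ t)) :
    path Θ '' Icc t (t + 1) =
      segment ℝ (path Θ t) (path Θ t + (1 / 2 : ℝ) * Complex.exp (Complex.I * (α : ℂ))) := by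
  have hpi := Real.pi_pos
  have hzero : ∀ x y, ∫ u in x..y, Real.sin (Θ u - α) = 0 := fun x y => by
    rw [← hΘ.height_sub, hc x, hc y, sub_self]
  have hlt' : ∀ u, u < t + 1 → Θ u < α + 2 * Real.pi := fun u hu => by
    have := hlt (u - 1) (by linarith)
    rw [hΘ.sub_one] at this; linarith
  -- The value `α + π/2` separates the two directions `α` and `α + π` available within the line.
  -- Thus `m` is the turning point, and comparing the two straight pieces there gives `m = t + 1/2`.
  obtain ⟨m, hm1, hm2⟩ := hΘ.exists_crossing (α + Real.pi / 2)
  have htm : t ≤ m := by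
    by_contra hcon
    obtain ⟨x, hx⟩ := exists_between (not_le.1 hcon)
    linarith [hlt x hx.2, hm2 x hx.1]
  have hmt : m ≤ t + 1 := by
    by_contra hcon
    obtain ⟨x, hx⟩ := exists_between (not_le.1 hcon)
    have := hge (x - 1) (by linarith [hx.1])
    rw [hΘ.sub_one] at this
    linarith [hm1 x hx.2]
  have h1 : ∀ u ∈ Ioo t m, Θ u = α := by
    intro u hu
    by_contra hne
    have h0 := lt_of_le_of_ne (hge u hu.1) (Ne.symm hne)
    refine (intervalIntegral.intervalIntegral_pos_of_pos_on (hΘ.intervalIntegrable_sin α u m)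
      (fun x hx => ?_) hu.2).ne' (hzero _ _)
    have h2 := hΘ.mono hx.1.le
    have h3 := hm1 x hx.2
    exact Real.sin_pos_of_pos_of_lt_pi (by linarith) (by linarith)
  have h2 : ∀ u ∈ Ioo m (t + 1), Θ u = α + Real.pi := by
    intro u hu
    rcases lt_trichotomy (Θ u) (α + Real.pi) with hlt1 | heq | hgt
    · exfalso
      refine (intervalIntegral.intervalIntegral_pos_of_pos_on (hΘ.intervalIntegrable_sin α m u)
        (fun x hx => ?_) hu.1).ne' (hzero _ _)
      have h2 := hΘ.mono hx.2.le
      have h3 := hm2 x hx.1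
      exact Real.sin_pos_of_pos_of_lt_pi (by linarith) (by linarith)
    · exact heq
    · exfalso
      refine (integral_neg_of_Ioo hu.2 (hΘ.intervalIntegrable_sin α u (t + 1))
        (fun x hx => ?_)).ne (hzero _ _)
      have h2 := hΘ.mono hx.1.le
      exact sin_neg_of (by linarith) (hlt' x hx.2)
  set e := Complex.exp (Complex.I * (α : ℂ)) with he
  have hepi : Complex.exp (Complex.I * ((α + Real.pi : ℝ) : ℂ)) = -e := by
    rw [he, exp_I_mul, exp_I_mul]; apply Complex.ext <;> simp
  have he0 : e ≠ 0 := Complex.exp_ne_zero _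
  have p1 : ∀ s ∈ Icc t m, path Θ s = path Θ t + ((s - t : ℝ) : ℂ) * e := fun s hs =>
    hΘ.path_eq_add_of_const hs.1 fun u hu => h1 u ⟨hu.1, hu.2.trans_le hs.2⟩
  have p2 : ∀ s ∈ Icc m (t + 1), path Θ s = path Θ t + ((t + 1 - s : ℝ) : ℂ) * e := fun s hs => by
    have := hΘ.path_eq_add_of_const hs.2 fun u hu => h2 u ⟨hs.1.trans_lt hu.1, hu.2⟩
    rw [hepi, hΘ.path_add_one] at this
    rw [this]; ring
  have hmid : m = t + 1 / 2 := by
    have := (p1 m ⟨htm, le_rfl⟩).symm.trans (p2 m ⟨le_rfl, hmt⟩)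
    have := mul_right_cancel₀ he0 (add_left_cancel this)
    have : m - t = t + 1 - m := by exact_mod_cast this
    linarith
  apply Subset.antisymm
  · rintro _ ⟨s, hs, rfl⟩
    have key : ∀ r : ℝ, r ∈ Icc (0 : ℝ) (1 / 2) → path Θ t + (r : ℂ) * e ∈
        segment ℝ (path Θ t) (path Θ t + (1 / 2 : ℝ) * e) := by
      intro r hr
      rw [segment_eq_image']
      refine ⟨2 * r, ⟨by linarith [hr.1], by linarith [hr.2]⟩, ?_⟩
      simp only [Complex.real_smul]
      push_cast; ring
    rcases le_total s m with hsm | hsm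
    · rw [p1 s ⟨hs.1, hsm⟩]
      exact key _ ⟨by linarith [hs.1], by linarith⟩
    · rw [p2 s ⟨hsm, hs.2⟩]
      exact key _ ⟨by linarith [hs.2], by linarith⟩
  · rw [segment_eq_image']
    rintro _ ⟨r, hr, rfl⟩
    refine ⟨t + r / 2, ⟨by linarith [hr.1], by linarith [hr.2]⟩, ?_⟩
    rw [p1 _ ⟨by linarith [hr.1], by linarith [hr.2]⟩]
    simp only [Complex.real_smul]
    push_cast; ring

end IsTurning

/-- The convex hull of a compact subset of a finite-dimensional space is compact. -/
lemma isCompact_convexHull {E : Type*} [NormedAddCommGroup E] [NormedSpace ℝ E]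
    [FiniteDimensional ℝ E] {s : Set E} (hs : IsCompact s) : IsCompact (convexHull ℝ s) := by
  rcases s.eq_empty_or_nonempty with rfl | ⟨x₀, hx₀⟩
  · simp
  -- By Carathéodory, `finrank + 1` points suffice, so the hull is a continuous image of a simplex
  -- times a power of `s`. Shorter combinations are padded with zero weights at `x₀`.
  set N := Module.finrank ℝ E + 1
  set F : (Fin N → ℝ) × (Fin N → E) → E := fun p => ∑ i, p.1 i • p.2 i with hF
  have hcont : Continuous F := by fun_prop
  have himg : convexHull ℝ s = F '' (stdSimplex ℝ (Fin N) ×ˢ univ.pi fun _ => s) := by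
    apply Subset.antisymm
    · intro x hx
      obtain ⟨ι, _, z, w, hz, hind, hw, hsum, hx⟩ := eq_pos_convex_span_of_mem_convexHull hx
      have hcard : Fintype.card ι ≤ Fintype.card (Fin N) := by
        rw [Fintype.card_fin]
        exact hind.card_le_finrank_succ.trans
          (Nat.succ_le_succ (Submodule.finrank_le _))
      obtain ⟨e⟩ := Function.Embedding.nonempty_of_card_le hcard
      refine ⟨(Function.extend e w 0, Function.extend e z fun _ => x₀), ⟨⟨fun i => ?_, ?_⟩, ?_⟩, ?_⟩
      · by_cases hi : ∃ j, e j = i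
        · obtain ⟨j, rfl⟩ := hi
          simp only [e.injective.extend_apply]; exact (hw j).le
        · simp [Function.extend_apply' _ _ _ hi]
      · rw [← hsum]
        refine (Fintype.sum_of_injective e e.injective _ _ (fun i hi => ?_) fun i => ?_).symm
        · exact Function.extend_apply' _ _ _ hi
        · exact (e.injective.extend_apply _ _ _).symm
      · intro i _
        by_cases hi : ∃ j, e j = i
        · obtain ⟨j, rfl⟩ := hi
          simp only [e.injective.extend_apply]; exact hz (mem_range_self j)
        · simp only [Function.extend_apply' _ _ _ hi]; exact hx₀
      · rw [← hx, hF]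
        refine (Fintype.sum_of_injective e e.injective _ _ (fun i hi => ?_) fun i => ?_).symm
        · simp only [Function.extend_apply' _ _ _ hi]; simp
        · simp only [e.injective.extend_apply]
    · rintro _ ⟨⟨w, z⟩, ⟨hw, hz⟩, rfl⟩
      exact (convex_convexHull ℝ s).sum_mem (fun i _ => hw.1 i) hw.2
        fun i _ => subset_convexHull ℝ s (hz i (mem_univ i))
  rw [himg]
  exact ((isCompact_stdSimplex ℝ (Fin N)).prod (isCompact_univ_pi fun _ => hs)).image hcont

/-! ### The convex region and its boundary -/

namespace IsTurning

variable {Θ : ℝ → ℝ}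

/-- The parameters around `t` up to which the curve runs straight in direction `α`. -/
def straight (Θ : ℝ → ℝ) (α t : ℝ) : Set ℝ :=
  {s | (∀ u ∈ Ioo t s, Θ u = α) ∧ ∀ u ∈ Ioo s t, Θ u = α}

lemma convex_straight (α t : ℝ) : Convex ℝ (straight Θ α t) := by
  rw [convex_iff_ordConnected]
  refine ⟨fun x hx y hy s hs => ⟨fun u hu => ?_, fun u hu => ?_⟩⟩
  · exact hy.1 u ⟨hu.1, hu.2.trans_le hs.2⟩
  · exact hx.2 u ⟨hs.1.trans_lt hu.1, hu.2⟩

lemma path_of_mem_straight (hΘ : IsTurning Θ) {α t s : ℝ} (hs : s ∈ straight Θ α t) :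
    path Θ s = path Θ t + ((s - t : ℝ) : ℂ) * Complex.exp (Complex.I * (α : ℂ)) := by
  rcases le_total t s with h | h
  · exact hΘ.path_eq_add_of_const h hs.1
  · rw [hΘ.path_eq_add_of_const h hs.2]
    push_cast; ring

lemma convex_image_straight (hΘ : IsTurning Θ) (α t : ℝ) :
    Convex ℝ (path Θ '' straight Θ α t) := by
  rintro _ ⟨x, hx, rfl⟩ _ ⟨y, hy, rfl⟩ p q hp hq hpq
  refine ⟨p • x + q • y, convex_straight α t hx hy hp hq hpq, ?_⟩
  rw [hΘ.path_of_mem_straight hx, hΘ.path_of_mem_straight hy,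
    hΘ.path_of_mem_straight (convex_straight α t hx hy hp hq hpq)]
  have : (p : ℂ) + q = 1 := by exact_mod_cast hpq
  simp only [Complex.real_smul, smul_eq_mul]
  push_cast
  linear_combination (-path Θ t + t * Complex.exp (Complex.I * α)) * this

lemma exists_mem_straight (hΘ : IsTurning Θ) {α t : ℝ} (h : IsCrossing Θ α t)
    (hnd : ∃ x, height α (path Θ x) ≠ height α (path Θ t)) {s : ℝ}
    (he : height α (path Θ s) = height α (path Θ t)) :
    ∃ s' ∈ straight Θ α t, s' ∈ Ico (t - 1) (t + 1) ∧ path Θ s = path Θ s' := by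
  obtain ⟨s', hs', hs⟩ := hΘ.exists_mem_Ico_path_eq t s
  rw [hs] at he
  rcases hΘ.eq_of_height_eq h he with h1 | h1 | h1
  · exact ⟨s', ⟨h1, fun u hu => absurd (hu.1.trans hu.2) (not_lt.2 hs'.1)⟩,
      ⟨by linarith [hs'.1], hs'.2⟩, hs⟩
  -- A straight arc that ends at `t + 1` is moved back by one period, so that it ends at `t`.
  · refine ⟨s' - 1, ⟨fun u hu => ?_, fun u hu => ?_⟩,
      ⟨by linarith [hs'.1], by linarith [hs'.2]⟩, ?_⟩
    · linarith [hu.1, hu.2, hs'.2]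
    · have := h1 (u + 1) ⟨by linarith [hu.1], by linarith [hu.2]⟩
      rw [hΘ.add_one] at this
      linarith
    · rw [hs, ← hΘ.path_add_one (s' - 1), sub_add_cancel]
  · obtain ⟨x, hx⟩ := hnd
    exact absurd (h1 x) hx

/-- The convex set bounded by the curve with tangent angle `Θ`. -/
def _root_.GaussMinkowski.region (Θ : ℝ → ℝ) : Set ℂ := convexHull ℝ (range (path Θ))

lemma image_Icc_eq_range (hΘ : IsTurning Θ) (t : ℝ) :
    path Θ '' Icc t (t + 1) = range (path Θ) :=
  hΘ.path_periodic.image_Icc one_pos t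

lemma isCompact_range (hΘ : IsTurning Θ) : IsCompact (range (path Θ)) := by
  rw [← hΘ.image_Icc_eq_range 0]
  exact isCompact_Icc.image hΘ.continuous_path

lemma isCompact_region (hΘ : IsTurning Θ) : IsCompact (region Θ) := isCompact_convexHull hΘ.isCompact_range

lemma convex_region : Convex ℝ (region Θ) := convex_convexHull ℝ _

lemma path_mem_region (t : ℝ) : path Θ t ∈ region Θ :=
  subset_convexHull ℝ _ (mem_range_self t)

lemma zero_mem_region : (0 : ℂ) ∈ region Θ := by
  rw [← path_zero (Θ := Θ)]; exact path_mem_region 0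

lemma height_le_of_mem_region (hΘ : IsTurning Θ) {α t : ℝ} (h : IsCrossing Θ α t) {z : ℂ}
    (hz : z ∈ region Θ) : height α (path Θ t) ≤ height α z := by
  have hconv : Convex ℝ {z | height α (path Θ t) ≤ height α z} :=
    convex_halfSpace_ge (height α).isLinear _
  refine convexHull_min ?_ hconv hz
  rintro _ ⟨s, rfl⟩
  exact hΘ.height_path_le h s

/-- The points of the region on a tangent line are points of the curve. -/
theorem mem_image_straight (hΘ : IsTurning Θ) {α t : ℝ} (h : IsCrossing Θ α t)
    (hnd : ∃ x, height α (path Θ x) ≠ height α (path Θ t)) {z : ℂ} (hz : z ∈ region Θ)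
    (he : height α z = height α (path Θ t)) :
    ∃ s ∈ straight Θ α t, s ∈ Ico (t - 1) (t + 1) ∧ z = path Θ s := by
  -- An open half-plane together with a convex piece of its bounding line is convex. It contains the
  -- curve, hence the region.
  set S : Set ℂ := {z | height α (path Θ t) < height α z} ∪
    path Θ '' (straight Θ α t) with hS
  have hge : ∀ z ∈ S, height α (path Θ t) ≤ height α z := by
    rintro z (hz | ⟨s, _, rfl⟩)
    · exact le_of_lt hz
    · exact hΘ.height_path_le h s
  have hconv : Convex ℝ S := by
    rw [convex_iff_forall_pos]
    intro x hx y hy p q hp hq hpq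
    by_cases hlt : height α (path Θ t) < height α x ∨ height α (path Θ t) < height α y
    · left
      have h1 := hge x hx
      have h2 := hge y hy
      simp only [mem_ofPred_eq, map_add, map_smul, smul_eq_mul]
      have h3 : height α (path Θ t) = p * height α (path Θ t) + q * height α (path Θ t) := by
        rw [← add_mul, hpq, one_mul]
      rw [h3]
      rcases hlt with hlt | hlt
      · exact add_lt_add_of_lt_of_le ((mul_lt_mul_iff_right₀ hp).2 hlt)
          ((mul_le_mul_iff_right₀ hq).2 h2)
      · exact add_lt_add_of_le_of_lt ((mul_le_mul_iff_right₀ hp).2 h1)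
          ((mul_lt_mul_iff_right₀ hq).2 hlt)
    · rw [not_or] at hlt
      exact Or.inr (hΘ.convex_image_straight α t (hx.resolve_left hlt.1)
        (hy.resolve_left hlt.2) hp.le hq.le hpq)
  have hsub : region Θ ⊆ S := by
    refine convexHull_min ?_ hconv
    rintro _ ⟨s, rfl⟩
    rcases (hΘ.height_path_le h s).lt_or_eq with h1 | h1
    · exact Or.inl h1
    · obtain ⟨s', hs', -, hs⟩ := hΘ.exists_mem_straight h hnd h1.symm
      exact Or.inr ⟨s', hs', hs.symm⟩
  rcases hsub hz with h1 | ⟨s, hs, rfl⟩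
  · exact absurd he (ne_of_gt h1)
  · obtain ⟨s', hs', hs2, hs3⟩ := hΘ.exists_mem_straight h hnd he
    exact ⟨s', hs', hs2, hs3⟩

/-- The curve is contained in a line. -/
def _root_.GaussMinkowski.IsFlat (Θ : ℝ → ℝ) : Prop := ∃ α, ∀ x, height α (path Θ x) = 0

lemma exists_ne_of_not_isFlat (hf : ¬ IsFlat Θ) (α t : ℝ) :
    ∃ x, height α (path Θ x) ≠ height α (path Θ t) := by
  by_contra hcon
  push Not at hcon
  have h0 := hcon 0
  rw [path_zero, map_zero] at h0
  exact hf ⟨α, fun x => by rw [hcon, ← h0]⟩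

/-- At a double point the curve returns to its own tangent line, so one of the two arcs between the
parameters is straight. A straight arc of positive length does not close up. -/
lemma injOn_path (hΘ : IsTurning Θ) (hf : ¬ IsFlat Θ) : InjOn (path Θ) (Ico 0 1) := by
  have key : ∀ s ∈ Ico (0 : ℝ) 1, ∀ t ∈ Ico (0 : ℝ) 1, t < s → path Θ s ≠ path Θ t := by
    intro s hs t ht hts he
    have hne : ∀ {x y : ℝ} {α : ℝ}, y < x → (∀ u ∈ Ioo y x, Θ u = α) → path Θ x ≠ path Θ y := by
      intro x y α hyx hc heq
      have := hΘ.path_eq_add_of_const hyx.le hc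
      rw [heq, left_eq_add, mul_eq_zero] at this
      rcases this with h0 | h0
      · have : x - y = 0 := by exact_mod_cast h0
        linarith
      · exact Complex.exp_ne_zero _ h0
    rcases hΘ.eq_of_height_eq (hΘ.isCrossing_self t) (congrArg _ he) with h1 | h1 | h1
    · exact hne hts h1 he
    · exact hne (by linarith [hs.2, ht.1]) h1 (by rw [hΘ.path_add_one, he])
    · obtain ⟨x, hx⟩ := exists_ne_of_not_isFlat hf (Θ t) t
      exact hx (h1 x)
  intro s hs t ht he
  rcases lt_trichotomy s t with h | h | h
  · exact absurd he.symm (key t ht s hs h)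
  · exact h
  · exact absurd he (key s hs t ht h)

/-- Without interior the curve, which passes through the origin, would lie in a proper linear
subspace. A nonzero functional vanishing there is a multiple of a height, so the curve would be
flat. -/
lemma interior_nonempty (hf : ¬ IsFlat Θ) : (interior (region Θ)).Nonempty := by
  rw [region, interior_convexHull_nonempty_iff_affineSpan_eq_top,
    AffineSubspace.affineSpan_eq_top_iff_vectorSpan_eq_top_of_nonempty _ _ _ (range_nonempty _)]
  by_contra hne
  obtain ⟨f, hf0, hle⟩ := Submodule.exists_le_ker_of_lt_top _ (lt_top_iff_ne_top.2 hne)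
  have hz : ∀ x, f (path Θ x) = 0 := fun x => by
    have : path Θ x -ᵥ path Θ 0 ∈ vectorSpan ℝ (range (path Θ)) :=
      vsub_mem_vectorSpan ℝ (mem_range_self x) (mem_range_self 0)
    rw [path_zero, vsub_eq_sub, sub_zero] at this
    exact hle this
  obtain ⟨r, hr, α, hα⟩ := exists_eq_height (LinearMap.toContinuousLinearMap f)
    (by simpa using hf0)
  refine hf ⟨α, fun x => ?_⟩
  have := (hα (path Θ x)).symm.trans (hz x)
  exact (mul_eq_zero.1 this).resolve_left hr.ne'

/-- A small move in the direction `Θ t - π/2`, the outer normal, crosses the supporting tangent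
line. -/
lemma path_notMem_interior (hΘ : IsTurning Θ) (t : ℝ) : path Θ t ∉ interior (region Θ) := by
  intro hmem
  obtain ⟨ε, hε, hball⟩ := Metric.mem_nhds_iff.1 (mem_interior_iff_mem_nhds.1 hmem)
  set v := Complex.exp (Complex.I * ((Θ t - Real.pi / 2 : ℝ) : ℂ)) with hv
  have hmem : path Θ t + ((ε / 2 : ℝ) : ℂ) * v ∈ region Θ := by
    apply hball
    rw [Metric.mem_ball, dist_eq_norm, add_sub_cancel_left, norm_mul, hv, norm_exp_I_mul,
      Complex.norm_real, Real.norm_eq_abs, abs_of_pos (by positivity)]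
    linarith
  have h1 := hΘ.height_le_of_mem_region (hΘ.isCrossing_self t) hmem
  have h2 : height (Θ t) (((ε / 2 : ℝ) : ℂ) * v) = - (ε / 2) := by
    rw [← Complex.real_smul, map_smul, hv, height_exp,
      show Θ t - Real.pi / 2 - Θ t = - (Real.pi / 2) by ring, Real.sin_neg, Real.sin_pi_div_two]
    simp
  rw [map_add, h2] at h1
  linarith

/-- A boundary point lies on a supporting line by Hahn–Banach. That line has some direction `α`,
hence is the tangent line at a crossing of `α`, and its points in the region belong to the curve. -/
theorem boundary_region_of_not_isFlat (hΘ : IsTurning Θ) (hf : ¬ IsFlat Θ) :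
    boundary (region Θ) = range (path Θ) := by
  have hint := interior_nonempty hf
  apply Subset.antisymm
  · rintro z ⟨hz, hz'⟩
    obtain ⟨f, hf1⟩ := geometric_hahn_banach_open_point convex_region.interior isOpen_interior
      (hz' hint)
    have hle : ∀ w ∈ region Θ, f w ≤ f z := by
      intro w hw
      have hcl : w ∈ closure (interior (region Θ)) := by
        rw [convex_region.closure_interior_eq_closure_of_nonempty_interior hint]
        exact subset_closure hw
      exact closure_minimal (fun x hx => (hf1 x hx).le)
        (isClosed_le f.continuous continuous_const) hcl
    obtain ⟨x, hx⟩ := hint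
    have hne : -f ≠ 0 := by
      intro h0
      have := hf1 x hx
      rw [neg_eq_zero.1 h0] at this
      simp at this
    obtain ⟨r, hr, α, hα⟩ := exists_eq_height (-f) hne
    obtain ⟨t, ht1, ht2⟩ := hΘ.exists_crossing α
    have hcr : IsCrossing Θ α t := ⟨fun u hu => (ht1 u hu).le, ht2⟩
    have h1 := hΘ.height_le_of_mem_region hcr hz
    have h2 : height α z ≤ height α (path Θ t) := by
      have := hle _ (path_mem_region t)
      have h3 := hα z
      have h4 := hα (path Θ t)
      simp only [neg_apply] at h3 h4
      refine le_of_mul_le_mul_left ?_ hr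
      linarith
    obtain ⟨s, -, -, hs⟩ := hΘ.mem_image_straight hcr (exists_ne_of_not_isFlat hf α t) hz
      (le_antisymm h2 h1)
    exact ⟨s, hs.symm⟩
  · rintro _ ⟨t, rfl⟩
    exact ⟨path_mem_region t, fun _ => hΘ.path_notMem_interior t⟩

lemma range_eq_segment_of_isFlat (hΘ : IsTurning Θ) {α : ℝ}
    (hα : ∀ x, height α (path Θ x) = 0) {t : ℝ}
    (hlt : ∀ u, u < t → Θ u < α) (hge : ∀ u, t < u → α ≤ Θ u) :
    range (path Θ) =
      segment ℝ (path Θ t) (path Θ t + (1 / 2 : ℝ) * Complex.exp (Complex.I * (α : ℂ))) := by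
  rw [← hΘ.image_Icc_eq_range t]
  exact hΘ.image_eq_segment_of_height_const hlt hge fun x => by rw [hα, hα]

lemma region_eq_range_of_isFlat (hΘ : IsTurning Θ) (hf : IsFlat Θ) :
    region Θ = range (path Θ) := by
  obtain ⟨α, hα⟩ := hf
  obtain ⟨t, hlt, hge⟩ := hΘ.exists_crossing α
  rw [region, hΘ.range_eq_segment_of_isFlat hα hlt hge]
  exact (convex_segment _ _).convexHull_eq

theorem boundary_region (hΘ : IsTurning Θ) : boundary (region Θ) = range (path Θ) := by
  by_cases hf : IsFlat Θ
  · have h1 := hΘ.region_eq_range_of_isFlat hf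
    apply Subset.antisymm
    · rintro z ⟨hz, -⟩
      rwa [← h1]
    · rintro _ ⟨t, rfl⟩
      exact ⟨path_mem_region t, fun _ => hΘ.path_notMem_interior t⟩
  · exact hΘ.boundary_region_of_not_isFlat hf

end IsTurning

/-- A compact convex set is determined by its boundary. -/
lemma convexHull_boundary {C : Set ℂ} (hc : IsCompact C) (hC : Convex ℝ C)
    (hb : IsCompact (boundary C)) : convexHull ℝ (boundary C) = C := by
  apply Subset.antisymm
  · exact convexHull_min (fun z hz => hz.1) hC
  -- Extreme points are never interior, so Krein–Milman applies.
  · have hext : C.extremePoints ℝ ⊆ boundary C := fun z hz =>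
      ⟨hz.1, fun _ hint => (disjoint_interior_extremePoints C).le_bot ⟨hint, hz⟩⟩
    rw [← closure_convexHull_extremePoints hc hC]
    refine closure_minimal (convexHull_mono ?_) ?_
    · rw [closure_convexHull_extremePoints hc hC]; exact hext
    · rw [closure_convexHull_extremePoints hc hC]; exact (isCompact_convexHull hb).isClosed

/-! ### Arc length, perimeter and membership in `Conv(1)` -/

namespace IsTurning

variable {Θ : ℝ → ℝ}

lemma ae_hasDerivAt_path (hΘ : IsTurning Θ) :
    ∀ᵐ t, HasDerivAt (path Θ) (Complex.exp (Complex.I * (Θ t : ℂ))) t := by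
  have hloc : LocallyIntegrable (fun u => Complex.exp (Complex.I * (Θ u : ℂ))) volume := by
    apply (locallyIntegrable_const (1 : ℝ)).mono hΘ.measurable_exp.aestronglyMeasurable
    filter_upwards with u
    rw [norm_exp_I_mul]; simp
  filter_upwards [LocallyIntegrable.ae_hasDerivAt_integral hloc] with t ht
  exact ht 0

lemma eVariationOn_Icc_le (hΘ : IsTurning Θ) {x y : ℝ} :
    eVariationOn (path Θ) (Icc x y) ≤ ENNReal.ofReal (y - x) := by
  have h1 := (hΘ.lipschitz_path.lipschitzOnWith (s := univ)).comp_eVariationOn_le (g := id)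
    (s := Icc x y) (fun _ _ => mem_univ _)
  rw [ENNReal.coe_one, one_mul, Function.comp_id] at h1
  refine h1.trans ?_
  rcases le_total x y with hxy | hxy
  · have := (monotoneOn_id (s := Icc x y)).eVariationOn_eq (a := x) (b := y)
      (left_mem_Icc.2 hxy) (right_mem_Icc.2 hxy)
    rw [inter_self] at this
    exact this.le
  · rw [eVariationOn.subsingleton _ (subsingleton_Icc_of_ge hxy)]
    simp

/-- The variation function `V` is monotone and dominates the chords of the curve. The curve has
speed `1` almost everywhere, so `V' ≥ 1` almost everywhere, and a monotone function increases by at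
least the integral of its derivative. -/
lemma le_eVariationOn_Icc (hΘ : IsTurning Θ) {x y : ℝ} (hxy : x ≤ y) :
    ENNReal.ofReal (y - x) ≤ eVariationOn (path Θ) (Icc x y) := by
  have hbv : LocallyBoundedVariationOn (path Θ) univ := fun a b _ _ => by
    rw [univ_inter]
    exact ne_top_of_le_ne_top ENNReal.ofReal_ne_top hΘ.eVariationOn_Icc_le
  set V : ℝ → ℝ := variationOnFromTo (path Θ) univ 0 with hV
  have hVsub : ∀ {s t : ℝ}, s ≤ t → V t - V s = (eVariationOn (path Θ) (Icc s t)).toReal := by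
    intro s t hst
    have := variationOnFromTo.add hbv (mem_univ 0) (mem_univ s) (mem_univ t)
    rw [variationOnFromTo.eq_of_le _ _ hst, univ_inter] at this
    linarith
  have hne : ∀ {s t : ℝ}, eVariationOn (path Θ) (Icc s t) ≠ ⊤ := fun {s t} =>
    ne_top_of_le_ne_top ENNReal.ofReal_ne_top hΘ.eVariationOn_Icc_le
  have hmono : Monotone V := fun s t hst => by
    rw [← sub_nonneg, hVsub hst]; exact ENNReal.toReal_nonneg
  have hle : ∀ {s t : ℝ}, s ≤ t → ‖path Θ t - path Θ s‖ ≤ V t - V s := by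
    intro s t hst
    rw [hVsub hst, ← dist_eq_norm, dist_edist]
    exact ENNReal.toReal_mono hne
      (eVariationOn.edist_le _ (right_mem_Icc.2 hst) (left_mem_Icc.2 hst))
  have hderiv : ∀ᵐ t, 1 ≤ deriv V t := by
    filter_upwards [hΘ.ae_hasDerivAt_path, hmono.ae_differentiableAt] with t h1 h2
    have h3 := (hasDerivAt_iff_tendsto_slope.1 h1).norm
    rw [norm_exp_I_mul] at h3
    refine le_of_tendsto_of_tendsto h3 (hasDerivAt_iff_tendsto_slope.1 h2.hasDerivAt) ?_
    filter_upwards [self_mem_nhdsWithin] with u hu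
    rw [slope_def_module, slope_def_field, norm_smul, norm_inv, Real.norm_eq_abs]
    rcases lt_or_gt_of_ne hu with hlt | hlt
    · rw [abs_of_neg (sub_neg.2 hlt), norm_sub_rev, div_eq_inv_mul]
      have := hle hlt.le
      have h4 : (u - t)⁻¹ < 0 := inv_lt_zero.2 (sub_neg.2 hlt)
      rw [inv_neg]
      nlinarith
    · rw [abs_of_pos (sub_pos.2 hlt), div_eq_inv_mul]
      exact mul_le_mul_of_nonneg_left (hle hlt.le) (inv_nonneg.2 (sub_pos.2 hlt).le)
  have hint : y - x ≤ V y - V x := by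
    have h1 := (hmono.monotoneOn (uIcc x y)).intervalIntegral_deriv_mem_uIcc
    rw [uIcc_of_le (sub_nonneg.2 (hmono hxy))] at h1
    refine le_trans ?_ h1.2
    have h2 : ∫ _ in x..y, (1 : ℝ) = y - x := by simp
    rw [← h2]
    exact intervalIntegral.integral_mono_ae hxy intervalIntegrable_const
      (hmono.monotoneOn (uIcc x y)).intervalIntegrable_deriv hderiv
  rw [← ENNReal.ofReal_toReal (hne (s := x) (t := y)), ← hVsub hxy]
  exact ENNReal.ofReal_le_ofReal hint

theorem hasUnitSpeedOn_path (hΘ : IsTurning Θ) (a b : ℝ) : HasUnitSpeedOn (path Θ) (Icc a b) := by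
  rw [HasUnitSpeedOn, hasConstantSpeedOnWith_iff_ordered]
  intro x hx y hy hxy
  have : Icc a b ∩ Icc x y = Icc x y :=
    inter_eq_right.2 (Icc_subset_Icc hx.1 hy.2)
  rw [this, NNReal.coe_one, one_mul]
  exact le_antisymm hΘ.eVariationOn_Icc_le (hΘ.le_eVariationOn_Icc hxy)

lemma isNaturalParam_path (hΘ : IsTurning Θ) (hf : ¬ IsFlat Θ) :
    IsNaturalParam (path Θ) 1 (boundary (region Θ)) where
  continuousOn := hΘ.continuous_path.continuousOn
  injOn := hΘ.injOn_path hf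
  closed := by simpa using (hΘ.path_add_one 0).symm
  image_eq := by simpa [hΘ.boundary_region] using hΘ.image_Icc_eq_range 0
  unitSpeed := hΘ.hasUnitSpeedOn_path 0 1

lemma hasPerimeter_region (hΘ : IsTurning Θ) : HasPerimeter (region Θ) 1 := by
  by_cases hf : IsFlat Θ
  · right
    rw [hΘ.region_eq_range_of_isFlat hf]
    obtain ⟨α, hα⟩ := hf
    obtain ⟨t, hlt, hge⟩ := hΘ.exists_crossing α
    refine ⟨_, _, hΘ.range_eq_segment_of_isFlat hα hlt hge, ?_⟩
    rw [dist_self_add_right, norm_mul, norm_exp_I_mul, Complex.norm_real]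
    norm_num
  · exact Or.inl ⟨interior_nonempty hf, one_pos, path Θ, hΘ.isNaturalParam_path hf⟩

theorem memConvOne_region (hΘ : IsTurning Θ) (hlt : ∀ u, u < 0 → Θ u < 0)
    (hge : ∀ u, 0 < u → 0 ≤ Θ u) : MemConvOne (region Θ) where
  isCompact := hΘ.isCompact_region
  convex := convex_region
  perimeter := hΘ.hasPerimeter_region
  zero_mem := zero_mem_region
  im_nonneg := by
    intro z hz
    have := hΘ.height_le_of_mem_region ⟨fun u hu => (hlt u hu).le, hge⟩ hz
    simpa [path_zero, height_apply] using this
  re_nonneg := by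
    intro z hz him
    have hcr : IsCrossing Θ 0 0 := ⟨fun u hu => (hlt u hu).le, hge⟩
    by_cases hf : IsFlat Θ
    · rw [hΘ.region_eq_range_of_isFlat hf] at hz
      obtain ⟨α, hα⟩ := hf
      -- Either the flat curve lies in the real axis, and then its segment leaves `0` in the
      -- direction `1`, or its line meets the real axis at `0` only.
      by_cases hs : Real.sin α = 0
      · have h0 : ∀ x, height 0 (path Θ x) = 0 := by
          intro x
          have h1 := hα x
          rw [height_apply, hs] at h1
          have hc : Real.cos α ≠ 0 := by
            intro hc
            have := Real.sin_sq_add_cos_sq α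
            rw [hs, hc] at this
            norm_num at this
          have h2 : (path Θ x).im = 0 := by
            rw [zero_mul, sub_zero] at h1
            exact (mul_eq_zero.1 h1).resolve_left hc
          simp [height_apply, h2]
        rw [hΘ.range_eq_segment_of_isFlat h0 hlt hge, path_zero, segment_eq_image'] at hz
        obtain ⟨r, hr, rfl⟩ := hz
        simpa using hr.1
      · obtain ⟨x, rfl⟩ := hz
        have h1 := hα x
        rw [height_apply, him, mul_zero, zero_sub, neg_eq_zero] at h1
        exact ((mul_eq_zero.1 h1).resolve_left hs).ge
    · obtain ⟨s, hs, hs', rfl⟩ := hΘ.mem_image_straight hcr (exists_ne_of_not_isFlat hf 0 0) hz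
        (by simp [height_apply, path_zero, him])
      -- The edge of direction `0` cannot extend to negative parameters, where `Θ < 0`.
      have hs0 : 0 ≤ s := by
        by_contra hneg
        obtain ⟨u, hu⟩ := exists_between (not_le.1 hneg)
        exact (hlt u hu.2).ne (hs.2 u hu)
      rw [hΘ.path_of_mem_straight hs, path_zero]
      simpa using hs0

end IsTurning

/-- There is only one convex set with a given compact boundary. -/
lemma IsConvexSetOf.eq_convexHull {μ : Measure T} {C : Set ℂ} (h : IsConvexSetOf μ C)
    (hc : IsCompact (curve μ)) : C = convexHull ℝ (curve μ) := by
  rw [← h.2]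
  exact (convexHull_boundary h.1.isCompact h.1.convex (by rw [h.2]; exact hc)).symm

/-! ### The area as a line integral -/

/-- A Lipschitz map of the line maps null sets to null sets. -/
lemma volume_image_eq_zero {g : ℝ → ℝ} (hg : LipschitzWith 1 g) {s : Set ℝ}
    (hs : volume s = 0) : volume (g '' s) = 0 := by
  rw [← hausdorffMeasure_real] at hs ⊢
  have := (hg.lipschitzOnWith (s := s)).hausdorffMeasure_image_le zero_le_one
  rw [hs, mul_zero] at this
  exact le_antisymm this zero_le

/-- Change of variables along a monotone Lipschitz function that need not be injective. -/
theorem integral_comp_monotoneOn {g w F φ : ℝ → ℝ} {a b : ℝ} (hab : a ≤ b)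
    (hg : LipschitzWith 1 g) (hd : ∀ᵐ t, HasDerivAt g (w t) t) (hmono : MonotoneOn g (Icc a b))
    (hφ : ∀ t ∈ Icc a b, g a < g t → g t < g b → φ (g t) = F t)
    (hF : Continuous F) (hw : IntervalIntegrable w volume a b) :
    IntervalIntegrable φ volume (g a) (g b) ∧
      ∫ y in (g a)..(g b), φ y = ∫ t in a..b, w t * F t := by
  set n : Set ℝ := toMeasurable volume {t | ¬ HasDerivAt g (w t) t} with hn
  have hn0 : volume n = 0 := by rw [hn, measure_toMeasurable]; exact hd
  set s : Set ℝ := Ioo a b \ n with hs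
  have hsm : MeasurableSet s := measurableSet_Ioo.diff (measurableSet_toMeasurable _ _)
  have hder : ∀ t ∈ s, HasDerivAt g (w t) t := fun t ht => by
    by_contra hcon
    exact ht.2 (subset_toMeasurable _ _ hcon)
  have hsub : s ⊆ Icc a b := sdiff_subset.trans Ioo_subset_Icc_self
  have hsae : s =ᵐ[volume] Ioc a b :=
    (sdiff_null_ae_eq_self hn0).trans Ioo_ae_eq_Ioc
  have himg : g '' s =ᵐ[volume] Ioc (g a) (g b) := by
    have hrange : g '' Icc a b = Icc (g a) (g b) := by
      apply Subset.antisymm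
      · rintro _ ⟨t, ht, rfl⟩
        exact ⟨hmono (left_mem_Icc.2 hab) ht ht.1, hmono ht (right_mem_Icc.2 hab) ht.2⟩
      · exact intermediate_value_Icc hab hg.continuous.continuousOn
    have h1 : g '' s =ᵐ[volume] g '' Icc a b := by
      refine ae_eq_set.2 ⟨by rw [sdiff_eq_empty.2 (image_mono hsub), measure_empty], ?_⟩
      refine measure_mono_null ?_ (volume_image_eq_zero hg
        (measure_union_null hn0 ((Set.toFinite {a, b}).measure_zero _)))
      rintro _ ⟨⟨t, ht, rfl⟩, hts⟩
      refine mem_image_of_mem g ?_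
      by_contra h
      simp only [mem_union, mem_insert_iff, mem_singleton_iff, not_or] at h
      exact hts (mem_image_of_mem g
        ⟨⟨lt_of_le_of_ne ht.1 (Ne.symm h.2.1), lt_of_le_of_ne ht.2 h.2.2⟩, h.1⟩)
    rw [hrange] at h1
    exact h1.trans Ioc_ae_eq_Icc.symm
  -- Where `g t` equals `g a` or `g b`, an interior `t` is a local extremum, so `w t = 0` and the
  -- value of `φ` is irrelevant. This disposes of horizontal edges.
  have hval : ∀ t ∈ s, w t • φ (g t) = w t * F t := by
    intro t ht
    have htI := hsub ht
    have h1 := hmono (left_mem_Icc.2 hab) htI htI.1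
    have h2 := hmono htI (right_mem_Icc.2 hab) htI.2
    rcases h1.lt_or_eq with h1 | h1
    · rcases h2.lt_or_eq with h2 | h2
      · rw [hφ t htI h1 h2, smul_eq_mul]
      · have : IsLocalMax g t := by
          filter_upwards [Icc_mem_nhds ht.1.1 ht.1.2] with u hu
          rw [h2]; exact hmono hu (right_mem_Icc.2 hab) hu.2
        rw [this.hasDerivAt_eq_zero (hder t ht)]; simp
    · have : IsLocalMin g t := by
        filter_upwards [Icc_mem_nhds ht.1.1 ht.1.2] with u hu
        rw [← h1]; exact hmono (left_mem_Icc.2 hab) hu hu.1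
      rw [this.hasDerivAt_eq_zero (hder t ht)]; simp
  have hder' : ∀ t ∈ s, HasDerivWithinAt g (w t) s t := fun t ht => (hder t ht).hasDerivWithinAt
  have hga : g a ≤ g b := hmono (left_mem_Icc.2 hab) (right_mem_Icc.2 hab) hab
  constructor
  · rw [intervalIntegrable_iff_integrableOn_Ioc_of_le hga, ← integrableOn_congr_set_ae himg,
      integrableOn_image_iff_integrableOn_deriv_smul_of_monotoneOn hsm hder' (hmono.mono hsub),
      integrableOn_congr_fun hval hsm, integrableOn_congr_set_ae hsae,
      ← intervalIntegrable_iff_integrableOn_Ioc_of_le hab]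
    exact hw.mul_continuousOn hF.continuousOn
  · rw [intervalIntegral.integral_of_le hga, intervalIntegral.integral_of_le hab,
      ← setIntegral_congr_set himg,
      integral_image_eq_integral_deriv_smul_of_monotoneOn hsm hder' (hmono.mono hsub),
      setIntegral_congr_fun hsm hval, setIntegral_congr_set hsae]

lemma height_zero (z : ℂ) : height 0 z = z.im := by simp [height_apply]

lemma height_pi (z : ℂ) : height Real.pi z = -z.im := by simp [height_apply]

/-- The area of a planar set that lies in a horizontal strip, by integration over its horizontal
slices. -/
lemma volume_real_eq_integral_slices {C : Set ℂ} (hC : MeasurableSet C) {H : ℝ} {l r : ℝ → ℝ}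
    (hH : 0 ≤ H) (him : ∀ z ∈ C, z.im ∈ Icc 0 H)
    (hlr : ∀ y ∈ Ioo 0 H, l y ≤ r y)
    (hslice : ∀ y ∈ Ioo 0 H, {x : ℝ | (⟨x, y⟩ : ℂ) ∈ C} = Icc (l y) (r y))
    (hl : IntervalIntegrable l volume 0 H) (hr : IntervalIntegrable r volume 0 H) :
    volume.real C = (∫ y in (0 : ℝ)..H, r y) - ∫ y in (0 : ℝ)..H, l y := by
  have h1 : volume C = ∫⁻ y in Ioo 0 H, ENNReal.ofReal (r y - l y) := by
    rw [← (Complex.volume_preserving_equiv_real_prod.symm).measure_preimage hC.nullMeasurableSet,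
      Measure.volume_eq_prod, Measure.prod_apply_symm
        (Complex.measurableEquivRealProd.symm.measurable hC),
      ← lintegral_indicator measurableSet_Ioo]
    have hne : ∀ᵐ y : ℝ, y ≠ 0 ∧ y ≠ H := by
      have := (Set.toFinite ({0, H} : Set ℝ)).countable.ae_notMem (volume : Measure ℝ)
      filter_upwards [this] with y hy
      simpa using hy
    refine lintegral_congr_ae ?_
    filter_upwards [hne] with y hy
    have hpre : (fun x : ℝ => (x, y)) ⁻¹' (Complex.measurableEquivRealProd.symm ⁻¹' C) =
        {x : ℝ | (⟨x, y⟩ : ℂ) ∈ C} := by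
      ext x
      rfl
    rw [hpre]
    by_cases hyI : y ∈ Ioo 0 H
    · rw [indicator_of_mem hyI, hslice y hyI, Real.volume_Icc]
    · rw [indicator_of_notMem hyI]
      convert measure_empty (μ := (volume : Measure ℝ))
      refine eq_empty_of_forall_notMem fun x hx => hyI ?_
      have := him _ hx
      exact ⟨lt_of_le_of_ne this.1 (Ne.symm hy.1), lt_of_le_of_ne this.2 hy.2⟩
  have hint : IntervalIntegrable (fun y => r y - l y) volume 0 H := hr.sub hl
  have hint' : IntegrableOn (fun y => r y - l y) (Ioo 0 H) :=
    ((intervalIntegrable_iff_integrableOn_Ioo_of_le hH).1 hint)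
  rw [← intervalIntegral.integral_sub hr hl, measureReal_def, h1,
    ← ofReal_integral_eq_lintegral_ofReal hint', ENNReal.toReal_ofReal,
    intervalIntegral.integral_of_le hH, integral_Ioc_eq_integral_Ioo]
  · exact setIntegral_nonneg measurableSet_Ioo fun y hy => sub_nonneg.2 (hlr y hy)
  · filter_upwards [ae_restrict_mem measurableSet_Ioo] with y hy
    exact sub_nonneg.2 (hlr y hy)

namespace IsTurning

variable {Θ : ℝ → ℝ}

lemma im_sub (hΘ : IsTurning Θ) (s t : ℝ) :
    (path Θ s).im - (path Θ t).im = ∫ u in t..s, Real.sin (Θ u) := by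
  have := hΘ.height_sub 0 s t
  simpa [height_zero] using this

/-- For points of equal imaginary part, the supporting inequality at `t` compares real parts
multiplied by `sin (Θ t)`, which is positive here. -/
lemma re_le_of_mem_region (hΘ : IsTurning Θ) {t : ℝ} (h0 : 0 < Θ t) (hpi : Θ t < Real.pi)
    {z : ℂ} (hz : z ∈ region Θ) (him : z.im = (path Θ t).im) : z.re ≤ (path Θ t).re := by
  have h1 := hΘ.height_le_of_mem_region (hΘ.isCrossing_self t) hz
  rw [height_apply, height_apply, him] at h1
  have := Real.sin_pos_of_pos_of_lt_pi h0 hpi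
  exact le_of_mul_le_mul_left (by linarith) this

lemma le_re_of_mem_region (hΘ : IsTurning Θ) {t : ℝ} (h0 : Real.pi < Θ t)
    (hpi : Θ t < 2 * Real.pi) {z : ℂ} (hz : z ∈ region Θ) (him : z.im = (path Θ t).im) :
    (path Θ t).re ≤ z.re := by
  have h1 := hΘ.height_le_of_mem_region (hΘ.isCrossing_self t) hz
  rw [height_apply, height_apply, him] at h1
  have h2 := sin_neg_of (x := Θ t) (α := 0) (by linarith) (by linarith)
  rw [sub_zero] at h2
  nlinarith

lemma ae_hasDerivAt_im (hΘ : IsTurning Θ) :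
    ∀ᵐ t, HasDerivAt (fun t => (path Θ t).im) (Real.sin (Θ t)) t := by
  filter_upwards [hΘ.ae_hasDerivAt_path] with t ht
  have := (Complex.imCLM.hasFDerivAt (x := path Θ t)).comp_hasDerivAt t ht
  rw [exp_I_mul] at this
  exact this

lemma lipschitz_im (hΘ : IsTurning Θ) : LipschitzWith 1 fun t => (path Θ t).im := by
  apply LipschitzWith.of_dist_le_mul
  intro s t
  rw [Real.dist_eq, Real.dist_eq, ← Complex.sub_im]
  simpa using (Complex.abs_im_le_norm _).trans (hΘ.norm_path_sub_le s t)

/-- The area of the region is the line integral of `x dy` along the curve. -/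
theorem volume_region (hΘ : IsTurning Θ) (hlt : ∀ u, u < 0 → Θ u < 0)
    (hge : ∀ u, 0 < u → 0 ≤ Θ u) :
    volume.real (region Θ) = ∫ t in (0 : ℝ)..1, Real.sin (Θ t) * (path Θ t).re := by
  have hpi := Real.pi_pos
  -- The curve climbs until its direction reaches `π` and descends afterwards: `[0, m]` is the right
  -- side of the region and `[m, 1]` the left side.
  obtain ⟨m, hm1, hm2⟩ := hΘ.exists_crossing Real.pi
  have hlt' : ∀ u, u < 1 → Θ u < 2 * Real.pi := fun u hu => by
    have := hlt (u - 1) (by linarith)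
    rw [hΘ.sub_one] at this; linarith
  have hge' : ∀ u, 1 < u → 2 * Real.pi ≤ Θ u := fun u hu => by
    have := hge (u - 1) (by linarith)
    rw [hΘ.sub_one] at this; linarith
  have hm0 : 0 ≤ m := by
    by_contra hcon
    obtain ⟨x, hx⟩ := exists_between (not_le.1 hcon)
    linarith [hlt x hx.2, hm2 x hx.1]
  have hm_one : m ≤ 1 := by
    by_contra hcon
    obtain ⟨x, hx⟩ := exists_between (not_le.1 hcon)
    linarith [hge' x hx.1, hm1 x hx.2]
  set g : ℝ → ℝ := fun t => (path Θ t).im with hg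
  set F : ℝ → ℝ := fun t => (path Θ t).re with hF
  set H := g m with hH
  have hg0 : g 0 = 0 := by simp [hg, path_zero]
  have hg1 : g 1 = 0 := by
    have := hΘ.path_add_one 0
    rw [zero_add, path_zero] at this
    simp [hg, this]
  have hFc : Continuous F := Complex.continuous_re.comp hΘ.continuous_path
  have hgc : Continuous g := Complex.continuous_im.comp hΘ.continuous_path
  have hmono : MonotoneOn g (Icc 0 m) := by
    intro s hs t ht hst
    rw [← sub_nonneg, hg, hΘ.im_sub]
    exact integral_nonneg_of_Ioo hst fun u hu => Real.sin_nonneg_of_nonneg_of_le_pi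
      (hge u (hs.1.trans_lt hu.1)) (hm1 u (hu.2.trans_le ht.2)).le
  have hanti : AntitoneOn g (Icc m 1) := by
    intro s hs t ht hst
    rw [← sub_nonpos, hg, hΘ.im_sub]
    refine integral_nonpos_of_Ioo hst fun u hu => ?_
    have := sin_nonpos_of (x := Θ u) (α := 0) (by linarith [hm2 u (hs.1.trans_lt hu.1)])
      (by linarith [hlt' u (hu.2.trans_le ht.2)])
    simpa using this
  have hH0 : 0 ≤ H := by
    rw [← hg0]; exact hmono ⟨le_rfl, hm0⟩ ⟨hm0, le_rfl⟩ hm0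
  have hup : ∀ t ∈ Icc 0 m, 0 < g t → g t < H → 0 < Θ t ∧ Θ t < Real.pi := by
    intro t ht h0 h1
    have ht0 : 0 < t := lt_of_le_of_ne ht.1 (by rintro rfl; exact h0.ne' hg0)
    have htm : t < m := lt_of_le_of_ne ht.2 (by rintro rfl; exact h1.ne rfl)
    refine ⟨lt_of_le_of_ne (hge t ht0) fun hc => h0.ne' ?_, hm1 t htm⟩
    have := hΘ.path_eq_add_of_const (α := 0) ht.1 fun u hu =>
      le_antisymm (hc ▸ hΘ.mono hu.2.le) (hge u hu.1)
    rw [hg]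
    simp [this, path_zero]
  have hdown : ∀ t ∈ Icc m 1, 0 < g t → g t < H → Real.pi < Θ t ∧ Θ t < 2 * Real.pi := by
    intro t ht h0 h1
    have ht1 : t < 1 := lt_of_le_of_ne ht.2 (by rintro rfl; exact h0.ne' hg1)
    have htm : m < t := lt_of_le_of_ne ht.1 (by rintro rfl; exact h1.ne rfl)
    refine ⟨lt_of_le_of_ne (hm2 t htm) fun hc => h1.ne ?_, hlt' t ht1⟩
    have := hΘ.path_eq_add_of_const (α := Real.pi) ht.1 fun u hu =>
      le_antisymm (hc ▸ hΘ.mono hu.2.le) (hm2 u hu.1)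
    rw [hH, hg]
    simp only [this, exp_I_mul, Complex.add_im, Complex.mul_im]
    simp
  have him : ∀ z ∈ region Θ, z.im ∈ Icc 0 H := by
    intro z hz
    have h1 := hΘ.height_le_of_mem_region ⟨fun u hu => (hlt u hu).le, hge⟩ hz
    have h2 := hΘ.height_le_of_mem_region ⟨fun u hu => (hm1 u hu).le, hm2⟩ hz
    rw [height_zero, height_zero, path_zero] at h1
    rw [height_pi, height_pi] at h2
    exact ⟨h1, by linarith [h2]⟩
  set r : ℝ → ℝ := fun y => sSup (Complex.re '' {z ∈ region Θ | z.im = y}) with hr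
  set l : ℝ → ℝ := fun y => sInf (Complex.re '' {z ∈ region Θ | z.im = y}) with hl
  have hrF : ∀ t ∈ Icc 0 m, 0 < g t → g t < H → r (g t) = F t := by
    intro t ht h0 h1
    obtain ⟨h2, h3⟩ := hup t ht h0 h1
    refine IsGreatest.csSup_eq ⟨⟨path Θ t, ⟨path_mem_region t, rfl⟩, rfl⟩, ?_⟩
    rintro _ ⟨z, ⟨hz, hzi⟩, rfl⟩
    exact hΘ.re_le_of_mem_region h2 h3 hz hzi
  have hlF : ∀ t ∈ Icc m 1, 0 < g t → g t < H → l (g t) = F t := by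
    intro t ht h0 h1
    obtain ⟨h2, h3⟩ := hdown t ht h0 h1
    refine IsLeast.csInf_eq ⟨⟨path Θ t, ⟨path_mem_region t, rfl⟩, rfl⟩, ?_⟩
    rintro _ ⟨z, ⟨hz, hzi⟩, rfl⟩
    exact hΘ.le_re_of_mem_region h2 h3 hz hzi
  have hsin : ∀ a b, IntervalIntegrable (fun t => Real.sin (Θ t)) volume a b := fun a b => by
    simpa using hΘ.intervalIntegrable_sin 0 a b
  obtain ⟨hri, hrint⟩ := integral_comp_monotoneOn hm0 hΘ.lipschitz_im hΘ.ae_hasDerivAt_im hmono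
    (φ := r) (F := F) (fun t ht h0 h1 => hrF t ht (by rwa [← hg0]) h1) hFc (hsin 0 m)
  -- The left side is traversed downwards, so the change of variables is applied to its mirror
  -- image.
  obtain ⟨hli, hlint⟩ := integral_comp_monotoneOn (g := fun t => - g t)
    (w := fun t => - Real.sin (Θ t)) hm_one hΘ.lipschitz_im.neg
    (by filter_upwards [hΘ.ae_hasDerivAt_im] with t ht using ht.neg) hanti.neg
    (φ := fun y => l (- y)) (F := F) (fun t ht h0 h1 => by
      rw [neg_neg]
      exact hlF t ht (by rw [hg1] at h1; linarith) (by linarith)) hFc (hsin m 1).neg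
  have hli' : IntervalIntegrable l volume 0 H := by
    have := (IntervalIntegrable.iff_comp_neg (by simp)).1 hli
    simp only [neg_neg] at this
    rw [hg1] at this
    exact this.symm
  have hlint' : ∫ y in (0 : ℝ)..H, l y = - ∫ t in m..1, Real.sin (Θ t) * F t := by
    rw [intervalIntegral.integral_comp_neg (fun y => l y), neg_neg, neg_neg, hg1] at hlint
    rw [hlint, ← intervalIntegral.integral_neg]
    simp only [neg_mul]
  change IntervalIntegrable r volume (g 0) H at hri
  change ∫ y in (g 0)..H, r y = _ at hrint
  rw [hg0] at hri hrint
  have hslice : ∀ y ∈ Ioo 0 H, l y ≤ r y ∧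
      {x : ℝ | (⟨x, y⟩ : ℂ) ∈ region Θ} = Icc (l y) (r y) := by
    intro y hy
    obtain ⟨t, ht, hty⟩ : y ∈ g '' Icc 0 m :=
      intermediate_value_Icc hm0 hgc.continuousOn (by rw [hg0]; exact Ioo_subset_Icc_self hy)
    obtain ⟨s, hs, hsy⟩ : y ∈ g '' Icc m 1 :=
      intermediate_value_Icc' hm_one hgc.continuousOn (by rw [hg1]; exact Ioo_subset_Icc_self hy)
    obtain ⟨t1, t2⟩ := hup t ht (hty ▸ hy.1) (hty ▸ hy.2)
    obtain ⟨s1, s2⟩ := hdown s hs (hsy ▸ hy.1) (hsy ▸ hy.2)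
    have hrt : r y = F t := by rw [← hty]; exact hrF t ht (hty ▸ hy.1) (hty ▸ hy.2)
    have hls : l y = F s := by rw [← hsy]; exact hlF s hs (hsy ▸ hy.1) (hsy ▸ hy.2)
    have hle : F s ≤ F t := hΘ.re_le_of_mem_region t1 t2 (path_mem_region s) (hsy.trans hty.symm)
    refine ⟨by rw [hrt, hls]; exact hle, ?_⟩
    rw [hrt, hls]
    apply Subset.antisymm
    · intro x hx
      exact ⟨hΘ.le_re_of_mem_region s1 s2 hx hsy.symm, hΘ.re_le_of_mem_region t1 t2 hx hty.symm⟩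
    · intro x hx
      rw [← segment_eq_Icc hle] at hx
      obtain ⟨p, q, hp, hq, hpq, rfl⟩ := hx
      have := convex_region (path_mem_region (Θ := Θ) s) (path_mem_region (Θ := Θ) t) hp hq hpq
      change (⟨p • F s + q • F t, y⟩ : ℂ) ∈ region Θ
      refine mem_of_eq_of_mem ?_ this
      apply Complex.ext
      · simp [hF]
      · have h1 : (path Θ s).im = y := hsy
        have h2 : (path Θ t).im = y := hty
        simp only [Complex.add_im, Complex.smul_im, h1, h2, smul_eq_mul]
        rw [← add_mul, hpq, one_mul]
  rw [volume_real_eq_integral_slices hΘ.isCompact_region.measurableSet hH0 him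
    (fun y hy => (hslice y hy).1) (fun y hy => (hslice y hy).2) hli' hri, hrint, hlint',
    sub_neg_eq_add, intervalIntegral.integral_add_adjacent_intervals]
  · exact (hsin 0 m).mul_continuousOn hFc.continuousOn
  · exact (hsin m 1).mul_continuousOn hFc.continuousOn

end IsTurning

/-! ### Fourier series of the Green function -/

/-- On `[0, 2π]`, a multiple of the periodic Green function of `f + f''`. -/
def green (x : ℝ) : ℝ := (1 - x / Real.pi) * Real.sin x

/-- The case `m = 0` is consistent with division by zero: the integral of `1 - x/π` over the period
vanishes. -/
lemma integral_one_sub_mul_exp (m : ℤ) :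
    ∫ x in (0 : ℝ)..2 * Real.pi,
      (1 - (x : ℂ) / Real.pi) * Complex.exp (Complex.I * m * x) = 2 * Complex.I / m := by
  have hpi : (Real.pi : ℂ) ≠ 0 := Complex.ofReal_ne_zero.2 Real.pi_ne_zero
  by_cases hm : m = 0
  · subst hm
    have h : ∀ x : ℝ, (1 - (x : ℂ) / Real.pi) * Complex.exp (Complex.I * ((0 : ℤ) : ℂ) * x) =
        ((1 - x / Real.pi : ℝ) : ℂ) := fun x => by simp
    simp_rw [h]
    rw [intervalIntegral.integral_ofReal, intervalIntegral.integral_sub (by simp)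
      (by apply Continuous.intervalIntegrable; fun_prop), intervalIntegral.integral_div]
    simp only [integral_id, intervalIntegral.integral_const]
    have := Real.pi_ne_zero
    norm_num
    field_simp
    norm_num
  · have hm' : (m : ℂ) ≠ 0 := Int.cast_ne_zero.2 hm
    have hI := Complex.I_ne_zero
    set c : ℂ := Complex.I * m with hc
    have hc0 : c ≠ 0 := mul_ne_zero hI hm'
    have hder : ∀ x : ℝ, HasDerivAt
        (fun x : ℝ => (1 - (x : ℂ) / Real.pi) * (Complex.exp (c * x) / c) +
          Complex.exp (c * x) / (Real.pi * c ^ 2))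
        ((1 - (x : ℂ) / Real.pi) * Complex.exp (c * x)) x := by
      intro x
      have h1 : HasDerivAt (fun x : ℝ => Complex.exp (c * x)) (Complex.exp (c * x) * (c * 1)) x :=
        ((Complex.ofRealCLM.hasDerivAt (x := x)).const_mul c).cexp
      have h2 : HasDerivAt (fun x : ℝ => 1 - (x : ℂ) / Real.pi) (-(1 / Real.pi)) x :=
        ((Complex.ofRealCLM.hasDerivAt (x := x)).div_const _).const_sub 1
      have h3 := (h2.mul (h1.div_const c)).add (h1.div_const (Real.pi * c ^ 2))
      refine h3.congr_deriv ?_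
      field_simp
      ring
    rw [intervalIntegral.integral_eq_sub_of_hasDerivAt (fun x _ => hder x)
      (by apply Continuous.intervalIntegrable; fun_prop)]
    have hexp : Complex.exp (c * ((2 * Real.pi : ℝ) : ℂ)) = 1 := by
      rw [Complex.exp_eq_one_iff]
      exact ⟨m, by rw [hc]; push_cast; ring⟩
    rw [hexp]
    simp only [Complex.ofReal_zero, mul_zero, Complex.exp_zero, hc]
    push_cast
    field_simp
    linear_combination (-2 * Real.pi * Complex.I * m) * Complex.I_sq

/-- Writing the sine as exponentials shifts the frequency by `±1`. At `n = ±1` the resonant term is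
zero, in agreement with `0⁻¹ = 0`. -/
lemma integral_exp_mul_green (n : ℤ) :
    ∫ x in (0 : ℝ)..2 * Real.pi, Complex.exp (-(Complex.I * n * x)) * (green x : ℂ) =
      (1 - (n : ℂ))⁻¹ + (1 + (n : ℂ))⁻¹ := by
  have h : ∀ x : ℝ, Complex.exp (-(Complex.I * n * x)) * (green x : ℂ) =
      Complex.I / 2 * ((1 - (x : ℂ) / Real.pi) * Complex.exp (Complex.I * ((-n - 1 : ℤ) : ℂ) * x)) -
      Complex.I / 2 * ((1 - (x : ℂ) / Real.pi) * Complex.exp (Complex.I * ((1 - n : ℤ) : ℂ) * x)) := by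
    intro x
    rw [green]
    push_cast
    rw [Complex.sin, show Complex.I * (-n - 1) * x = -(Complex.I * n * x) + -x * Complex.I by ring,
      show Complex.I * (1 - n) * x = -(Complex.I * n * x) + x * Complex.I by ring,
      Complex.exp_add, Complex.exp_add]
    ring
  simp_rw [h]
  rw [intervalIntegral.integral_sub (by apply Continuous.intervalIntegrable; fun_prop)
    (by apply Continuous.intervalIntegrable; fun_prop), intervalIntegral.integral_const_mul,
    intervalIntegral.integral_const_mul, integral_one_sub_mul_exp, integral_one_sub_mul_exp]
  push_cast
  rw [div_eq_mul_inv, div_eq_mul_inv, div_eq_mul_inv,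
    show -(n : ℂ) - 1 = -(1 + n) by ring, inv_neg]
  linear_combination (-(1 - (n : ℂ))⁻¹ - (1 + (n : ℂ))⁻¹) * Complex.I_sq

lemma summable_inv_one_sub_add :
    Summable fun n : ℤ => (1 / (2 * Real.pi) : ℂ) * ((1 - (n : ℂ))⁻¹ + (1 + (n : ℂ))⁻¹) := by
  apply Summable.mul_left
  have hs : Summable fun n : ℤ => 4 * (1 / (n : ℝ) ^ 2) :=
    (Real.summable_one_div_int_pow.2 one_lt_two).mul_left 4
  refine hs.of_norm_bounded_eventually ?_
  have hfin : ∀ᶠ n : ℤ in Filter.cofinite, n ∉ ({0, 1, -1} : Set ℤ) :=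
    (Set.toFinite _).compl_mem_cofinite
  filter_upwards [hfin] with n hn
  simp only [mem_insert_iff, mem_singleton_iff, not_or] at hn
  have h4 : (4 : ℤ) ≤ n ^ 2 := by
    have : 2 ≤ |n| := by
      rcases abs_cases n with h | h <;> omega
    nlinarith [sq_abs n]
  have h4' : (4 : ℝ) ≤ (n : ℝ) ^ 2 := by exact_mod_cast h4
  have h1 : (1 - (n : ℂ)) ≠ 0 := by
    intro h
    apply hn.2.1
    have : (n : ℂ) = 1 := (sub_eq_zero.1 h).symm
    exact_mod_cast this
  have h2 : (1 + (n : ℂ)) ≠ 0 := by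
    intro h
    apply hn.2.2
    have : (n : ℂ) = -1 := by linear_combination h
    exact_mod_cast this
  have he : (1 - (n : ℂ))⁻¹ + (1 + (n : ℂ))⁻¹ = ((2 / (1 - (n : ℝ) ^ 2) : ℝ) : ℂ) := by
    push_cast
    rw [show (1 : ℂ) - n ^ 2 = (1 - n) * (1 + n) by ring]
    field_simp
    ring
  rw [he, Complex.norm_real, Real.norm_eq_abs, abs_div, abs_of_neg (by linarith : 1 - (n : ℝ) ^ 2 < 0),
    abs_two, mul_one_div, div_le_div_iff₀ (by linarith) (by linarith)]
  linarith

/-- The Fourier series of the Green function. -/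
theorem hasSum_green {x : ℝ} (hx : x ∈ Icc 0 (2 * Real.pi)) :
    HasSum (fun k : ℕ => -(2 / Real.pi) *
        (Real.cos ((k + 2 : ℕ) * x) / (((k + 2 : ℕ) : ℝ) ^ 2 - 1)))
      (green x - 1 / Real.pi - Real.cos x / (2 * Real.pi)) := by
  have hpi := Real.pi_pos
  have hpi0 : (Real.pi : ℂ) ≠ 0 := Complex.ofReal_ne_zero.2 Real.pi_ne_zero
  have : Fact (0 < 2 * Real.pi) := ⟨by positivity⟩
  set G : ℝ → ℂ := fun x => (green x : ℂ) with hG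
  have hGc : Continuous G := by
    rw [hG]; unfold green; fun_prop
  -- The periodic extension is continuous; with summable coefficients its Fourier series converges
  -- to it pointwise.
  have hends : G 0 = G (0 + 2 * Real.pi) := by simp [hG, green]
  set f : C(AddCircle (2 * Real.pi), ℂ) :=
    ⟨AddCircle.liftIco (2 * Real.pi) 0 G, AddCircle.liftIco_continuous hends hGc.continuousOn⟩
    with hf
  have hcoef : ∀ n : ℤ, fourierCoeff f n =
      (1 / (2 * Real.pi) : ℂ) * ((1 - (n : ℂ))⁻¹ + (1 + (n : ℂ))⁻¹) := by
    intro n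
    change fourierCoeff (AddCircle.liftIco (2 * Real.pi) 0 G) n = _
    rw [fourierCoeff_liftIco_eq, fourierCoeffOn_eq_integral, ← integral_exp_mul_green n]
    simp only [zero_add, sub_zero, smul_eq_mul, Complex.real_smul]
    push_cast
    congr 1
    refine intervalIntegral.integral_congr fun y _ => ?_
    simp only [fourier_coe_apply, hG]
    congr 2
    push_cast
    field_simp
    ring
  have hsum := has_pointwise_sum_fourier_series_of_summable (f := f)
    (by rw [show fourierCoeff f = _ from funext hcoef]; exact summable_inv_one_sub_add) (x : AddCircle (2 * Real.pi))
  have hmem : ∀ y ∈ Ico 0 (2 * Real.pi), f (y : AddCircle (2 * Real.pi)) = G y := fun y hy =>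
    AddCircle.liftIco_coe_apply (f := G) (p := 2 * Real.pi) (a := 0)
      ⟨hy.1, by rw [zero_add]; exact hy.2⟩
  have hval : f (x : AddCircle (2 * Real.pi)) = G x := by
    rcases hx.2.lt_or_eq with h | h
    · exact hmem x ⟨hx.1, h⟩
    · have h0 : (x : AddCircle (2 * Real.pi)) = ((0 : ℝ) : AddCircle (2 * Real.pi)) := by
        rw [h, AddCircle.coe_period]; rfl
      rw [h0, hmem 0 ⟨le_rfl, by positivity⟩, hends, zero_add, h]
  rw [hval] at hsum
  have hterm : ∀ n : ℕ, fourierCoeff f (n : ℤ) • fourier (n : ℤ) (x : AddCircle (2 * Real.pi)) +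
      fourierCoeff f (-(n : ℤ)) • fourier (-(n : ℤ)) (x : AddCircle (2 * Real.pi)) =
      ((1 / Real.pi * ((1 - (n : ℝ))⁻¹ + (1 + (n : ℝ))⁻¹) * Real.cos (n * x) : ℝ) : ℂ) := by
    intro n
    rw [hcoef, hcoef, fourier_coe_apply, fourier_coe_apply]
    push_cast
    rw [Complex.cos, show 2 * (Real.pi : ℂ) * Complex.I * n * x / (2 * Real.pi) =
      n * x * Complex.I by field_simp, show 2 * (Real.pi : ℂ) * Complex.I * (-n) * x / (2 * Real.pi) =
      -(n * x) * Complex.I by field_simp, sub_neg_eq_add, ← sub_eq_add_neg]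
    simp only [smul_eq_mul]
    field_simp
    ring
  -- Pairing `n` with `-n` counts the constant mode `1/π` twice, which is why `1/π` is added in `e2`
  -- before the terms `n = 0, 1` are removed.
  have h1 := hsum.nat_add_neg
  simp_rw [hterm] at h1
  have h0 : fourierCoeff f 0 • fourier 0 (x : AddCircle (2 * Real.pi)) = ((1 / Real.pi : ℝ) : ℂ) := by
    rw [hcoef]
    simp
    field_simp
    norm_num
  rw [h0, hG, ← Complex.ofReal_add, Complex.hasSum_ofReal, ← hasSum_nat_add_iff' 2] at h1
  have e1 : ∀ k : ℕ, -(2 / Real.pi) *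
      (Real.cos ((k + 2 : ℕ) * x) / (((k + 2 : ℕ) : ℝ) ^ 2 - 1)) =
      1 / Real.pi * ((1 - ((k + 2 : ℕ) : ℝ))⁻¹ + (1 + ((k + 2 : ℕ) : ℝ))⁻¹) *
        Real.cos ((k + 2 : ℕ) * x) := by
    intro k
    have hk0 : (0 : ℝ) ≤ k := Nat.cast_nonneg k
    push_cast
    have hk : (1 - ((k : ℝ) + 2)) ≠ 0 := by linarith
    have hk' : (1 + ((k : ℝ) + 2)) ≠ 0 := by positivity
    rw [inv_add_inv hk hk', show (((k : ℝ) + 2) ^ 2 - 1) =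
      -((1 - ((k : ℝ) + 2)) * (1 + ((k : ℝ) + 2))) by ring, div_neg]
    field_simp
    ring
  have e2 : green x - 1 / Real.pi - Real.cos x / (2 * Real.pi) = green x + 1 / Real.pi -
      ∑ i ∈ Finset.range 2, 1 / Real.pi * ((1 - (i : ℝ))⁻¹ + (1 + (i : ℝ))⁻¹) *
        Real.cos (i * x) := by
    simp only [Finset.sum_range_succ, Finset.sum_range_zero, Nat.cast_zero, Nat.cast_one]
    norm_num
    field_simp
    ring
  rw [e2, funext e1]
  exact h1

/-! ### The area as a mean over two independent tangent angles -/

/-- The uniform probability measure on the unit interval. -/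
abbrev unif : Measure ℝ := volume.restrict (Ioo 0 1)

instance : IsProbabilityMeasure unif := ⟨by simp⟩

lemma integral_unif (f : ℝ → ℝ) : ∫ t, f t ∂unif = ∫ t in (0 : ℝ)..1, f t := by
  rw [intervalIntegral.integral_of_le zero_le_one, integral_Ioc_eq_integral_Ioo]

namespace IsTurning

variable {Θ : ℝ → ℝ}

lemma integrable_of_measurable_of_bound {f : ℝ → ℝ} (hf : Measurable f) {c : ℝ}
    (hc : ∀ t ∈ Ioo (0 : ℝ) 1, |f t| ≤ c) : Integrable f unif := by
  refine Integrable.of_bound hf.aestronglyMeasurable c ?_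
  filter_upwards [ae_restrict_mem measurableSet_Ioo] with t ht using hc t ht

lemma intervalIntegrable_cos (hΘ : IsTurning Θ) (a b : ℝ) :
    IntervalIntegrable (fun u => Real.cos (Θ u)) volume a b := by
  have := hΘ.intervalIntegrable_sin (-(Real.pi / 2)) a b
  simpa [Real.sin_add_pi_div_two] using this

lemma intervalIntegrable_sin' (hΘ : IsTurning Θ) (a b : ℝ) :
    IntervalIntegrable (fun u => Real.sin (Θ u)) volume a b := by
  simpa using hΘ.intervalIntegrable_sin 0 a b

lemma re_sub (hΘ : IsTurning Θ) (s t : ℝ) :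
    (path Θ s).re - (path Θ t).re = ∫ u in t..s, Real.cos (Θ u) := by
  have := hΘ.height_sub (-(Real.pi / 2)) s t
  simpa [height_apply, Real.sin_add_pi_div_two] using this

lemma path_one (hΘ : IsTurning Θ) : path Θ 1 = 0 := by
  have := hΘ.path_add_one 0
  rwa [zero_add, path_zero] at this

lemma integral_cos_unif (hΘ : IsTurning Θ) : ∫ t, Real.cos (Θ t) ∂unif = 0 := by
  rw [integral_unif, ← hΘ.re_sub, hΘ.path_one, path_zero, sub_self]

lemma integral_sin_unif (hΘ : IsTurning Θ) : ∫ t, Real.sin (Θ t) ∂unif = 0 := by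
  rw [integral_unif, ← hΘ.im_sub, hΘ.path_one, path_zero, sub_self]

lemma lipschitz_re (hΘ : IsTurning Θ) : LipschitzWith 1 fun t => (path Θ t).re := by
  apply LipschitzWith.of_dist_le_mul
  intro s t
  rw [Real.dist_eq, Real.dist_eq, ← Complex.sub_re]
  simpa using (Complex.abs_re_le_norm _).trans (hΘ.norm_path_sub_le s t)

lemma ae_hasDerivAt_re (hΘ : IsTurning Θ) :
    ∀ᵐ t, HasDerivAt (fun t => (path Θ t).re) (Real.cos (Θ t)) t := by
  filter_upwards [hΘ.ae_hasDerivAt_path] with t ht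
  have := (Complex.reCLM.hasFDerivAt (x := path Θ t)).comp_hasDerivAt t ht
  rw [exp_I_mul] at this
  exact this

/-- The line integrals of `x dy` and `-y dx` along the curve agree. -/
lemma integral_sin_mul_re (hΘ : IsTurning Θ) :
    ∫ t in (0 : ℝ)..1, Real.sin (Θ t) * (path Θ t).re =
      - ∫ t in (0 : ℝ)..1, Real.cos (Θ t) * (path Θ t).im := by
  have hx := (hΘ.lipschitz_re.lipschitzOnWith (s := uIcc 0 1)).absolutelyContinuousOnInterval
  have hy := (hΘ.lipschitz_im.lipschitzOnWith (s := uIcc 0 1)).absolutelyContinuousOnInterval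
  have h := hx.integral_mul_deriv_eq_deriv_mul hy
  simp only [hΘ.path_one, path_zero, Complex.zero_re, Complex.zero_im, mul_zero, sub_self,
    zero_sub] at h
  have h1 : ∫ t in (0 : ℝ)..1, Real.sin (Θ t) * (path Θ t).re =
      ∫ t in (0 : ℝ)..1, (path Θ t).re * deriv (fun t => (path Θ t).im) t := by
    apply intervalIntegral.integral_congr_ae
    filter_upwards [hΘ.ae_hasDerivAt_im] with t ht _
    rw [ht.deriv, mul_comm]
  have h2 : ∫ t in (0 : ℝ)..1, Real.cos (Θ t) * (path Θ t).im =
      ∫ t in (0 : ℝ)..1, deriv (fun t => (path Θ t).re) t * (path Θ t).im := by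
    apply intervalIntegral.integral_congr_ae
    filter_upwards [hΘ.ae_hasDerivAt_re] with t ht _
    rw [ht.deriv]
  rw [h1, h2, h]

/-- Monotonicity resolves the absolute value on either side of `t`. The integrals over `[0, t]` and
`[t, 1]` contribute equally: closedness changes one sign and the absolute value the other. -/
lemma integral_sin_abs_sub (hΘ : IsTurning Θ) {t : ℝ} (ht : t ∈ Ioo (0 : ℝ) 1) :
    ∫ s, Real.sin |Θ t - Θ s| ∂unif =
      2 * (Real.sin (Θ t) * (path Θ t).re - Real.cos (Θ t) * (path Θ t).im) := by
  have hm := hΘ.mono.measurable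
  have hint : ∀ a b, IntervalIntegrable (fun s => Real.sin |Θ t - Θ s|) volume a b := by
    intro a b
    apply (intervalIntegrable_const (c := (1 : ℝ))).mono_fun
    · exact (by fun_prop : Measurable fun s => Real.sin |Θ t - Θ s|).aestronglyMeasurable
    · filter_upwards with u
      simpa using Real.abs_sin_le_one _
  have h1 : ∫ s in (0 : ℝ)..t, Real.sin |Θ t - Θ s| =
      Real.sin (Θ t) * (path Θ t).re - Real.cos (Θ t) * (path Θ t).im := by
    have hx := hΘ.re_sub t 0
    have hy := hΘ.im_sub t 0
    rw [path_zero, Complex.zero_re, sub_zero] at hx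
    rw [path_zero, Complex.zero_im, sub_zero] at hy
    rw [hx, hy, ← intervalIntegral.integral_const_mul, ← intervalIntegral.integral_const_mul,
      ← intervalIntegral.integral_sub ((hΘ.intervalIntegrable_cos _ _).const_mul _)
        ((hΘ.intervalIntegrable_sin' _ _).const_mul _)]
    refine intervalIntegral.integral_congr_Ioo_of_le ht.1.le fun s hs => ?_
    rw [abs_of_nonneg (sub_nonneg.2 (hΘ.mono hs.2.le)), Real.sin_sub]
  have h2 : ∫ s in t..1, Real.sin |Θ t - Θ s| =
      Real.sin (Θ t) * (path Θ t).re - Real.cos (Θ t) * (path Θ t).im := by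
    have hx := hΘ.re_sub 1 t
    have hy := hΘ.im_sub 1 t
    rw [hΘ.path_one, Complex.zero_re, zero_sub, neg_eq_iff_eq_neg] at hx
    rw [hΘ.path_one, Complex.zero_im, zero_sub, neg_eq_iff_eq_neg] at hy
    rw [hx, hy, mul_neg, mul_neg, sub_neg_eq_add, neg_add_eq_sub,
      ← intervalIntegral.integral_const_mul, ← intervalIntegral.integral_const_mul,
      ← intervalIntegral.integral_sub ((hΘ.intervalIntegrable_sin' _ _).const_mul _)
        ((hΘ.intervalIntegrable_cos _ _).const_mul _)]
    refine intervalIntegral.integral_congr_Ioo_of_le ht.2.le fun s hs => ?_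
    rw [abs_sub_comm, abs_of_nonneg (sub_nonneg.2 (hΘ.mono hs.1.le)), Real.sin_sub]
    ring
  rw [integral_unif, ← intervalIntegral.integral_add_adjacent_intervals (hint 0 t) (hint t 1),
    h1, h2]
  ring

lemma integral_prod_sin_abs_sub (hΘ : IsTurning Θ) :
    ∫ p, Real.sin |Θ p.1 - Θ p.2| ∂(unif.prod unif) =
      4 * ∫ t in (0 : ℝ)..1, Real.sin (Θ t) * (path Θ t).re := by
  have hm := hΘ.mono.measurable
  rw [integral_prod]
  · have h : ∫ t, ∫ s, Real.sin |Θ t - Θ s| ∂unif ∂unif = ∫ t,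
        2 * (Real.sin (Θ t) * (path Θ t).re - Real.cos (Θ t) * (path Θ t).im) ∂unif := by
      refine integral_congr_ae ?_
      filter_upwards [ae_restrict_mem measurableSet_Ioo] with t ht
      exact hΘ.integral_sin_abs_sub ht
    rw [h, integral_unif, intervalIntegral.integral_const_mul, intervalIntegral.integral_sub]
    · linarith [hΘ.integral_sin_mul_re]
    · exact (hΘ.intervalIntegrable_sin' _ _).mul_continuousOn
        (Complex.continuous_re.comp hΘ.continuous_path).continuousOn
    · exact (hΘ.intervalIntegrable_cos _ _).mul_continuousOn
        (Complex.continuous_im.comp hΘ.continuous_path).continuousOn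
  · refine Integrable.of_bound
      (by fun_prop : Measurable fun p : ℝ × ℝ => Real.sin |Θ p.1 - Θ p.2|).aestronglyMeasurable
      1 (Filter.Eventually.of_forall fun p => Real.abs_sin_le_one _)

lemma mem_Icc_of_mem_Ioo {u : ℝ} (hΘ : IsTurning Θ) (hlt : ∀ u, u < 0 → Θ u < 0)
    (hge : ∀ u, 0 < u → 0 ≤ Θ u) (hu : u ∈ Ioo (0 : ℝ) 1) : Θ u ∈ Icc 0 (2 * Real.pi) := by
  refine ⟨hge u hu.1, ?_⟩
  have := hlt (u - 1) (by linarith [hu.2])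
  rw [hΘ.sub_one] at this
  linarith

/-- Expanding the sine of the difference leaves in each product a factor `∫ cos Θ` or `∫ sin Θ`,
which is zero by closedness. This is what permits passing from `sin |x|` to `green |x|`. -/
lemma integral_prod_sub_mul_sin (hΘ : IsTurning Θ) (hlt : ∀ u, u < 0 → Θ u < 0)
    (hge : ∀ u, 0 < u → 0 ≤ Θ u) :
    Integrable (fun p : ℝ × ℝ => (Θ p.1 - Θ p.2) * Real.sin (Θ p.1 - Θ p.2)) (unif.prod unif) ∧
      ∫ p, (Θ p.1 - Θ p.2) * Real.sin (Θ p.1 - Θ p.2) ∂(unif.prod unif) = 0 := by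
  have hm := hΘ.mono.measurable
  have hb : ∀ t ∈ Ioo (0 : ℝ) 1, |Θ t| ≤ 2 * Real.pi := fun t ht => by
    have := hΘ.mem_Icc_of_mem_Ioo hlt hge ht
    rw [abs_of_nonneg this.1]; exact this.2
  have i1 : Integrable (fun t => Θ t * Real.sin (Θ t)) unif := by
    refine integrable_of_measurable_of_bound (by fun_prop) (c := 2 * Real.pi) fun t ht => ?_
    rw [abs_mul]
    exact (mul_le_of_le_one_right (abs_nonneg _) (Real.abs_sin_le_one _)).trans (hb t ht)
  have i2 : Integrable (fun t => Θ t * Real.cos (Θ t)) unif := by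
    refine integrable_of_measurable_of_bound (by fun_prop) (c := 2 * Real.pi) fun t ht => ?_
    rw [abs_mul]
    exact (mul_le_of_le_one_right (abs_nonneg _) (Real.abs_cos_le_one _)).trans (hb t ht)
  have i3 : Integrable (fun t => Real.sin (Θ t)) unif :=
    integrable_of_measurable_of_bound (by fun_prop) fun t _ => Real.abs_sin_le_one _
  have i4 : Integrable (fun t => Real.cos (Θ t)) unif :=
    integrable_of_measurable_of_bound (by fun_prop) fun t _ => Real.abs_cos_le_one _
  have he : (fun p : ℝ × ℝ => (Θ p.1 - Θ p.2) * Real.sin (Θ p.1 - Θ p.2)) = fun p =>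
      ((Θ p.1 * Real.sin (Θ p.1)) * Real.cos (Θ p.2) -
        (Θ p.1 * Real.cos (Θ p.1)) * Real.sin (Θ p.2)) -
      (Real.sin (Θ p.1) * (Θ p.2 * Real.cos (Θ p.2)) -
        Real.cos (Θ p.1) * (Θ p.2 * Real.sin (Θ p.2))) := by
    ext p
    rw [Real.sin_sub]; ring
  have j1 := i1.mul_prod i4
  have j2 := i2.mul_prod i3
  have j3 := i3.mul_prod i2
  have j4 := i4.mul_prod i1
  rw [he]
  refine ⟨(j1.sub j2).sub (j3.sub j4), ?_⟩
  have hsub := integral_sub (j1.sub j2) (j3.sub j4)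
  simp only [Pi.sub_apply] at hsub
  rw [hsub, integral_sub j1 j2, integral_sub j3 j4,
    integral_prod_mul (fun t => Θ t * Real.sin (Θ t)) (fun t => Real.cos (Θ t)),
    integral_prod_mul (fun t => Θ t * Real.cos (Θ t)) (fun t => Real.sin (Θ t)),
    integral_prod_mul (fun t => Real.sin (Θ t)) (fun t => Θ t * Real.cos (Θ t)),
    integral_prod_mul (fun t => Real.cos (Θ t)) (fun t => Θ t * Real.sin (Θ t)),
    hΘ.integral_cos_unif, hΘ.integral_sin_unif]
  ring

/-- The area as the mean of the Green function of two independent tangent angles. -/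
theorem integral_prod_green (hΘ : IsTurning Θ) (hlt : ∀ u, u < 0 → Θ u < 0)
    (hge : ∀ u, 0 < u → 0 ≤ Θ u) :
    Integrable (fun p : ℝ × ℝ => green |Θ p.1 - Θ p.2|) (unif.prod unif) ∧
    ∫ p, green |Θ p.1 - Θ p.2| ∂(unif.prod unif) = 4 * volume.real (region Θ) := by
  have hm := hΘ.mono.measurable
  obtain ⟨h1, h2⟩ := hΘ.integral_prod_sub_mul_sin hlt hge
  have h3 : Integrable (fun p : ℝ × ℝ => Real.sin |Θ p.1 - Θ p.2|) (unif.prod unif) :=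
    Integrable.of_bound
      (by fun_prop : Measurable fun p : ℝ × ℝ => Real.sin |Θ p.1 - Θ p.2|).aestronglyMeasurable
      1 (Filter.Eventually.of_forall fun p => Real.abs_sin_le_one _)
  have he : (fun p : ℝ × ℝ => green |Θ p.1 - Θ p.2|) = fun p => Real.sin |Θ p.1 - Θ p.2| -
      1 / Real.pi * ((Θ p.1 - Θ p.2) * Real.sin (Θ p.1 - Θ p.2)) := by
    ext p
    rw [green]
    rcases abs_cases (Θ p.1 - Θ p.2) with h | h
    · rw [h.1]; ring
    · rw [h.1, Real.sin_neg]; ring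
  rw [he]
  refine ⟨h3.sub (h1.const_mul _), ?_⟩
  rw [integral_sub h3 (h1.const_mul _), integral_const_mul, h2, hΘ.integral_prod_sin_abs_sub,
    hΘ.volume_region hlt hge, mul_zero, sub_zero]

lemma integral_prod_cos (hΘ : IsTurning Θ) (n : ℕ) :
    ∫ p, Real.cos (n * |Θ p.1 - Θ p.2|) ∂(unif.prod unif) =
      (∫ t, Real.cos (n * Θ t) ∂unif) ^ 2 + (∫ t, Real.sin (n * Θ t) ∂unif) ^ 2 := by
  have hm := hΘ.mono.measurable
  have i1 : Integrable (fun t => Real.cos (n * Θ t)) unif :=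
    integrable_of_measurable_of_bound (by fun_prop) fun t _ => Real.abs_cos_le_one _
  have i2 : Integrable (fun t => Real.sin (n * Θ t)) unif :=
    integrable_of_measurable_of_bound (by fun_prop) fun t _ => Real.abs_sin_le_one _
  have he : (fun p : ℝ × ℝ => Real.cos (n * |Θ p.1 - Θ p.2|)) = fun p =>
      Real.cos (n * Θ p.1) * Real.cos (n * Θ p.2) +
        Real.sin (n * Θ p.1) * Real.sin (n * Θ p.2) := by
    ext p
    have : Real.cos (n * |Θ p.1 - Θ p.2|) = Real.cos (n * (Θ p.1 - Θ p.2)) := by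
      rw [← Real.cos_abs, ← Real.cos_abs (n * (Θ p.1 - Θ p.2)), abs_mul, abs_mul, abs_abs]
    rw [this, mul_sub, Real.cos_sub]
  rw [he, integral_add (i1.mul_prod i1) (i2.mul_prod i2),
    integral_prod_mul (fun t => Real.cos (n * Θ t)) (fun t => Real.cos (n * Θ t)),
    integral_prod_mul (fun t => Real.sin (n * Θ t)) (fun t => Real.sin (n * Θ t))]
  ring

lemma summable_inv_sq_sub_one : Summable fun k : ℕ => 1 / (((k + 2 : ℕ) : ℝ) ^ 2 - 1) := by
  have h := (summable_nat_add_iff 1).2 (Real.summable_one_div_nat_pow.2 one_lt_two)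
  refine h.of_nonneg_of_le (fun k => ?_) fun k => ?_
  · have : (0 : ℝ) ≤ k := Nat.cast_nonneg k
    refine one_div_nonneg.2 ?_
    push_cast; nlinarith
  · have : (0 : ℝ) ≤ k := Nat.cast_nonneg k
    refine one_div_le_one_div_of_le (by positivity) ?_
    push_cast; nlinarith

/-- The area as a series in the Fourier coefficients of the law of the tangent angle. -/
theorem hasSum_volume_region (hΘ : IsTurning Θ) (hlt : ∀ u, u < 0 → Θ u < 0)
    (hge : ∀ u, 0 < u → 0 ≤ Θ u) :
    HasSum (fun k : ℕ => -(2 / Real.pi) *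
      (((∫ t, Real.cos ((k + 2 : ℕ) * Θ t) ∂unif) ^ 2 +
        (∫ t, Real.sin ((k + 2 : ℕ) * Θ t) ∂unif) ^ 2) / (((k + 2 : ℕ) : ℝ) ^ 2 - 1)))
      (4 * volume.real (region Θ) - 1 / Real.pi) := by
  have hm := hΘ.mono.measurable
  have hpi := Real.pi_pos
  obtain ⟨hg1, hg2⟩ := hΘ.integral_prod_green hlt hge
  have hpos : ∀ k : ℕ, 0 < (((k + 2 : ℕ) : ℝ) ^ 2 - 1) := fun k => by
    have : (0 : ℝ) ≤ k := Nat.cast_nonneg k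
    push_cast; nlinarith
  have key := hasSum_integral_of_dominated_convergence (μ := unif.prod unif)
    (F := fun (k : ℕ) (p : ℝ × ℝ) => -(2 / Real.pi) *
        (Real.cos ((k + 2 : ℕ) * |Θ p.1 - Θ p.2|) / (((k + 2 : ℕ) : ℝ) ^ 2 - 1)))
    (f := fun p => green |Θ p.1 - Θ p.2| - 1 / Real.pi -
      Real.cos |Θ p.1 - Θ p.2| / (2 * Real.pi))
    (fun k _ => 2 / Real.pi * (1 / (((k + 2 : ℕ) : ℝ) ^ 2 - 1)))
    (fun k => by
      apply Measurable.aestronglyMeasurable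
      fun_prop)
    (fun k => Filter.Eventually.of_forall fun p => by
      rw [norm_mul, norm_neg, Real.norm_of_nonneg (by positivity), norm_div,
        Real.norm_of_nonneg (hpos k).le]
      refine mul_le_mul_of_nonneg_left ?_ (by positivity)
      exact div_le_div_of_nonneg_right (Real.abs_cos_le_one _) (hpos k).le)
    (Filter.Eventually.of_forall fun _ => summable_inv_sq_sub_one.mul_left _)
    (integrable_const _)
    (by
      have h1 : ∀ᵐ p ∂(unif.prod unif), p ∈ Ioo (0 : ℝ) 1 ×ˢ Ioo (0 : ℝ) 1 := by
        rw [Measure.prod_restrict]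
        exact ae_restrict_mem (measurableSet_Ioo.prod measurableSet_Ioo)
      filter_upwards [h1] with p hp
      have h2 := hΘ.mem_Icc_of_mem_Ioo hlt hge hp.1
      have h3 := hΘ.mem_Icc_of_mem_Ioo hlt hge hp.2
      exact hasSum_green ⟨abs_nonneg _, abs_le.2 ⟨by linarith [h2.1, h3.2], by linarith [h2.2, h3.1]⟩⟩)
  have hc1 : Integrable (fun p : ℝ × ℝ => Real.cos |Θ p.1 - Θ p.2| / (2 * Real.pi))
      (unif.prod unif) :=
    (Integrable.of_bound
      (by fun_prop : Measurable fun p : ℝ × ℝ => Real.cos |Θ p.1 - Θ p.2|).aestronglyMeasurable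
      1 (Filter.Eventually.of_forall fun p => Real.abs_cos_le_one _)).div_const _
  -- The first mode disappears because the curve closes up.
  have hc2 : ∫ p, Real.cos |Θ p.1 - Θ p.2| ∂(unif.prod unif) = 0 := by
    have := hΘ.integral_prod_cos 1
    simp only [Nat.cast_one, one_mul, hΘ.integral_cos_unif, hΘ.integral_sin_unif] at this
    rw [this]; norm_num
  have hsub := integral_sub (hg1.sub (integrable_const (1 / Real.pi))) hc1
  simp only [Pi.sub_apply] at hsub
  rw [hsub, integral_sub hg1 (integrable_const _),
    hg2, integral_const (1 / Real.pi), integral_div, hc2] at key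
  simp only [probReal_univ, one_smul, zero_div, sub_zero] at key
  simp_rw [integral_const_mul, integral_div, hΘ.integral_prod_cos] at key
  exact key

end IsTurning

/-! ### The quantile function of `μ` as tangent angle -/

instance : Fact (0 < 2 * Real.pi) := ⟨by positivity⟩

/-- The angle in `[0, 2π)` of a point of the circle. -/
def angle (y : T) : ℝ := AddCircle.equivIco (2 * Real.pi) 0 y

lemma measurable_angle : Measurable angle :=
  measurable_subtype_coe.comp (AddCircle.measurableEquivIco (2 * Real.pi) 0).measurable

lemma coe_angle (y : T) : (angle y : T) = y := AddCircle.coe_equivIco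

lemma angle_nonneg (y : T) : 0 ≤ angle y := (AddCircle.equivIco (2 * Real.pi) 0 y).2.1

lemma angle_lt (y : T) : angle y < 2 * Real.pi :=
  (AddCircle.equivIco (2 * Real.pi) 0 y).2.2.trans_eq (zero_add _)

lemma angle_coe_le {s : ℝ} (hs : 0 ≤ s) : angle (s : T) ≤ s := by
  rcases lt_or_ge s (2 * Real.pi) with h | h
  · exact (AddCircle.equivIco_coe_of_mem (p := 2 * Real.pi) (a := 0)
      ⟨hs, by rwa [zero_add]⟩).le
  · exact (angle_lt _).le.trans h

/-- The angle is the least nonnegative representative of a point. Hence `cdf μ` is the distribution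
function of a law on the line, also for `x ≥ 2π`, where the arc wraps around. -/
lemma image_Icc_eq (x : ℝ) : (fun s : ℝ => (s : T)) '' Icc 0 x = angle ⁻¹' Iic x := by
  apply Subset.antisymm
  · rintro _ ⟨s, hs, rfl⟩
    exact (angle_coe_le hs.1).trans hs.2
  · intro y hy
    exact ⟨angle y, ⟨angle_nonneg y, hy⟩, coe_angle y⟩

section Quantile

variable (μ : Measure T)

lemma cdf_of_neg {x : ℝ} (hx : x < 0) : cdf μ x = 0 := by
  rw [cdf, Icc_eq_empty (not_le.2 hx), image_empty, measureReal_empty]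

lemma cdfInv_nonneg (u : ℝ) : 0 ≤ cdfInv μ u := Real.sInf_nonneg fun _ hx => hx.1

lemma bddBelow_cdfInv (u : ℝ) : BddBelow {x : ℝ | 0 ≤ x ∧ u ≤ cdf μ x} := ⟨0, fun _ hx => hx.1⟩

/-- The quasi-periodic extension of the quantile function. -/
def turning (u : ℝ) : ℝ := cdfInv μ (Int.fract u) + 2 * Real.pi * ⌊u⌋

lemma turning_of_mem {u : ℝ} (hu : u ∈ Ioo (0 : ℝ) 1) : turning μ u = cdfInv μ u := by
  have hf : ⌊u⌋ = 0 := Int.floor_eq_zero_iff.2 ⟨hu.1.le, hu.2⟩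
  rw [turning, hf, Int.fract, hf]; simp

lemma turning_nonneg {u : ℝ} (hu : 0 < u) : 0 ≤ turning μ u := by
  have h1 := cdfInv_nonneg μ (Int.fract u)
  have h2 : (0 : ℝ) ≤ ⌊u⌋ := by exact_mod_cast Int.floor_nonneg.2 hu.le
  rw [turning]
  have := Real.pi_pos
  positivity

lemma Z_eq_path {t : ℝ} (ht : t ∈ Icc (0 : ℝ) 1) : Z μ t = path (turning μ) t := by
  refine intervalIntegral.integral_congr_Ioo_of_le ht.1 fun u hu => ?_
  rw [turning_of_mem μ ⟨hu.1, hu.2.trans_le ht.2⟩]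

variable [IsProbabilityMeasure μ]

/-- The law of the angle in `[0, 2π)`. -/
def angleLaw : Measure ℝ := μ.map angle

instance : IsProbabilityMeasure (angleLaw μ) :=
  Measure.isProbabilityMeasure_map measurable_angle.aemeasurable

lemma cdf_eq (x : ℝ) : cdf μ x = ProbabilityTheory.cdf (angleLaw μ) x := by
  rw [ProbabilityTheory.cdf_eq_real, cdf, image_Icc_eq, angleLaw,
    map_measureReal_apply measurable_angle measurableSet_Iic]

lemma cdf_two_pi : cdf μ (2 * Real.pi) = 1 := by
  rw [cdf, image_Icc_eq, show angle ⁻¹' Iic (2 * Real.pi) = univ from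
    eq_univ_of_forall fun y => (angle_lt y).le, probReal_univ]

lemma two_pi_mem {u : ℝ} (hu : u ≤ 1) : 2 * Real.pi ∈ {x : ℝ | 0 ≤ x ∧ u ≤ cdf μ x} :=
  ⟨by positivity, by rwa [cdf_two_pi]⟩

/-- Right continuity of the distribution function means that the infimum is attained. -/
lemma le_cdf_cdfInv {u : ℝ} (hu : u ≤ 1) : u ≤ cdf μ (cdfInv μ u) := by
  have hr := (ProbabilityTheory.cdf (angleLaw μ)).right_continuous (cdfInv μ u)
  rw [cdf_eq]
  refine ge_of_tendsto (hr.tendsto.mono_left (nhdsWithin_mono _ Ioi_subset_Ici_self)) ?_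
  filter_upwards [self_mem_nhdsWithin] with x hx
  obtain ⟨v, hv, hvx⟩ := exists_lt_of_csInf_lt ⟨_, two_pi_mem μ hu⟩ hx
  rw [← cdf_eq]
  refine hv.2.trans ?_
  rw [cdf_eq, cdf_eq]
  exact ProbabilityTheory.monotone_cdf _ hvx.le

/-- The quantile function is the lower adjoint of the distribution function. -/
lemma cdfInv_le_iff {u x : ℝ} (hu : u ∈ Ioo (0 : ℝ) 1) : cdfInv μ u ≤ x ↔ u ≤ cdf μ x := by
  constructor
  · intro h
    refine (le_cdf_cdfInv μ hu.2.le).trans ?_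
    rw [cdf_eq, cdf_eq]
    exact ProbabilityTheory.monotone_cdf _ h
  · intro h
    have hx : 0 ≤ x := by
      by_contra hneg
      rw [cdf_of_neg μ (not_le.1 hneg)] at h
      exact absurd hu.1 (not_lt.2 h)
    exact csInf_le (bddBelow_cdfInv μ u) ⟨hx, h⟩

lemma cdfInv_mono {u v : ℝ} (huv : u ≤ v) (hv : v ≤ 1) : cdfInv μ u ≤ cdfInv μ v :=
  csInf_le_csInf (bddBelow_cdfInv μ u) ⟨_, two_pi_mem μ hv⟩ fun _ hx => ⟨hx.1, huv.trans hx.2⟩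

/-- The law of the angle has no atom at `2π`, so the distribution function exceeds `u` already to
the left of it. The strictness gives `turning μ u < 0` for `u < 0`, which fixes the starting point
of the curve. -/
lemma cdfInv_lt {u : ℝ} (hu : u < 1) : cdfInv μ u < 2 * Real.pi := by
  set G := ProbabilityTheory.cdf (angleLaw μ) with hG
  have h1 : G.measure {2 * Real.pi} = 0 := by
    rw [hG, ProbabilityTheory.measure_cdf, angleLaw,
      Measure.map_apply measurable_angle (measurableSet_singleton _),
      show angle ⁻¹' {2 * Real.pi} = ∅ from
        eq_empty_of_forall_notMem fun y hy => (angle_lt y).ne hy, measure_empty]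
  rw [StieltjesFunction.measure_singleton, ENNReal.ofReal_eq_zero, hG, ← cdf_eq, cdf_two_pi,
    sub_nonpos] at h1
  have h2 := G.mono.tendsto_leftLim (2 * Real.pi)
  have h3 : ∀ᶠ x in nhdsWithin (2 * Real.pi) (Iio (2 * Real.pi)), u < G x :=
    h2.eventually_const_lt (hu.trans_le h1)
  have h4 : ∀ᶠ x in nhdsWithin (2 * Real.pi) (Iio (2 * Real.pi)), 0 < x :=
    mem_nhdsWithin_of_mem_nhds (lt_mem_nhds (by positivity))
  obtain ⟨x, hx, hx0, hxlt⟩ := (h3.and (h4.and self_mem_nhdsWithin)).exists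
  refine lt_of_le_of_lt (csInf_le (bddBelow_cdfInv μ u) ⟨hx0.le, ?_⟩) hxlt
  rw [cdf_eq]; exact hx.le

lemma turning_neg {u : ℝ} (hu : u < 0) : turning μ u < 0 := by
  have h1 := cdfInv_lt μ (Int.fract_lt_one u)
  have h2 : ((⌊u⌋ : ℤ) : ℝ) ≤ -1 := by
    have : ⌊u⌋ < 0 := Int.floor_lt.2 (by simpa using hu)
    exact_mod_cast Int.le_sub_one_of_lt this
  rw [turning]
  nlinarith [Real.pi_pos]

lemma monotone_turning : Monotone (turning μ) := by
  intro u v huv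
  have hpi := Real.pi_pos
  rcases (Int.floor_mono huv).lt_or_eq with h | h
  · have h1 := cdfInv_lt μ (Int.fract_lt_one u)
    have h2 := cdfInv_nonneg μ (Int.fract v)
    have h3 : ((⌊u⌋ : ℤ) : ℝ) + 1 ≤ ⌊v⌋ := by exact_mod_cast h
    rw [turning, turning]
    nlinarith
  · rw [turning, turning, h]
    have : Int.fract u ≤ Int.fract v := by rw [Int.fract, Int.fract, h]; linarith
    linarith [cdfInv_mono μ this (Int.fract_lt_one v).le]

/-- The tangent angle at a uniform point of the curve has the law of `μ`. -/
theorem map_turning : unif.map (turning μ) = angleLaw μ := by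
  have hm := (monotone_turning μ).measurable
  have : IsProbabilityMeasure (unif.map (turning μ)) :=
    Measure.isProbabilityMeasure_map hm.aemeasurable
  refine Measure.ext_of_Iic _ _ fun x => ?_
  rw [Measure.map_apply hm measurableSet_Iic, ← ProbabilityTheory.ofReal_cdf, ← cdf_eq,
    Measure.restrict_apply (hm measurableSet_Iic)]
  have h0 : 0 ≤ cdf μ x := measureReal_nonneg
  have h1 : cdf μ x ≤ 1 := measureReal_le_one
  have he : turning μ ⁻¹' Iic x ∩ Ioo 0 1 = Iic (cdf μ x) ∩ Ioo 0 1 := by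
    ext u
    refine and_congr_left fun hu => ?_
    rw [mem_preimage, mem_Iic, mem_Iic, turning_of_mem μ hu, cdfInv_le_iff μ hu]
  have hae : (Iic (cdf μ x) ∩ Ioo 0 1 : Set ℝ) =ᵐ[volume] (Ioc 0 (cdf μ x) : Set ℝ) := by
    have h2 : (Iic (cdf μ x) ∩ Ioc 0 1 : Set ℝ) = Ioc 0 (cdf μ x) := by
      ext u
      simp only [mem_inter_iff, mem_Iic, mem_Ioc]
      exact ⟨fun h => ⟨h.2.1, h.1⟩, fun h => ⟨h.2, h.1, h.2.trans h1⟩⟩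
    rw [← h2]
    exact (ae_eq_refl _).inter Ioo_ae_eq_Ioc
  rw [he, measure_congr hae, Real.volume_Ioc, sub_zero]

variable {E : Type*} [NormedAddCommGroup E] [NormedSpace ℝ E]

lemma integral_eq_integral_turning {f : T → E} {h : ℝ → E} (hh : StronglyMeasurable h)
    (hfh : ∀ x : ℝ, f x = h x) : ∫ y, f y ∂μ = ∫ u, h (turning μ u) ∂unif := by
  rw [← integral_map (monotone_turning μ).measurable.aemeasurable hh.aestronglyMeasurable,
    map_turning, angleLaw, integral_map measurable_angle.aemeasurable hh.aestronglyMeasurable]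
  refine integral_congr_ae (Filter.Eventually.of_forall fun y => ?_)
  simp only
  rw [← hfh, coe_angle]

lemma a_eq (k : ℕ) : a μ k = 1 / Real.pi * ∫ u, Real.cos (k * turning μ u) ∂unif := by
  rw [a, integral_eq_integral_turning μ (h := fun x => Real.cos (k * x))
    (by fun_prop : Continuous fun x : ℝ => Real.cos (k * x)).stronglyMeasurable]
  intro x
  rw [← AddCircle.coe_nsmul, Function.Periodic.lift_coe, nsmul_eq_mul]

lemma b_eq (k : ℕ) : b μ k = 1 / Real.pi * ∫ u, Real.sin (k * turning μ u) ∂unif := by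
  rw [b, integral_eq_integral_turning μ (h := fun x => Real.sin (k * x))
    (by fun_prop : Continuous fun x : ℝ => Real.sin (k * x)).stronglyMeasurable]
  intro x
  rw [← AddCircle.coe_nsmul, Function.Periodic.lift_coe, nsmul_eq_mul]

variable {μ}

theorem isTurning_turning (hμ : MeanZero μ) : IsTurning (turning μ) where
  mono := monotone_turning μ
  add_one u := by
    rw [turning, turning, Int.fract_add_one, Int.floor_add_one]
    push_cast; ring
  closed := by
    rw [intervalIntegral.integral_of_le zero_le_one, integral_Ioc_eq_integral_Ioo, ← hμ,
      integral_eq_integral_turning μ (h := fun x : ℝ => Complex.exp (Complex.I * (x : ℂ)))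
        (by fun_prop : Continuous fun x : ℝ =>
          Complex.exp (Complex.I * (x : ℂ))).stronglyMeasurable]
    intro x
    rw [AddCircle.toCircle_apply_mk, Circle.coe_exp, div_self (by positivity), one_mul, mul_comm]

lemma curve_eq_range (hμ : MeanZero μ) : curve μ = range (path (turning μ)) := by
  rw [← (isTurning_turning hμ).image_Icc_eq_range 0, zero_add, curve]
  exact image_congr fun t ht => Z_eq_path μ ht

end Quantile

end GaussMinkowski

end

theorem mainTheorem7 (μ : MeasureTheory.Measure GaussMinkowski.T)
    [MeasureTheory.IsProbabilityMeasure μ] (hμ : GaussMinkowski.MeanZero μ) :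
    ∃ C : Set ℂ,
      (GaussMinkowski.IsConvexSetOf μ C ∧
        ∀ C' : Set ℂ, GaussMinkowski.IsConvexSetOf μ C' → C' = C) ∧
      Summable (fun k : ℕ =>
        (GaussMinkowski.a μ (k + 2) ^ 2 + GaussMinkowski.b μ (k + 2) ^ 2) /
          (((k + 2 : ℕ) : ℝ) ^ 2 - 1)) ∧
      MeasureTheory.volume.real C =
        1 / (4 * Real.pi) - Real.pi / 2 *
          ∑' k : ℕ, (GaussMinkowski.a μ (k + 2) ^ 2 + GaussMinkowski.b μ (k + 2) ^ 2) /
            (((k + 2 : ℕ) : ℝ) ^ 2 - 1) := by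
  have hΘ := GaussMinkowski.isTurning_turning hμ
  have hlt : ∀ u, u < 0 → GaussMinkowski.turning μ u < 0 :=
    fun _ => GaussMinkowski.turning_neg μ
  have hge : ∀ u, 0 < u → 0 ≤ GaussMinkowski.turning μ u :=
    fun _ => GaussMinkowski.turning_nonneg μ
  have hcurve := GaussMinkowski.curve_eq_range hμ
  have hpi := Real.pi_ne_zero
  have hsum : HasSum (fun k : ℕ =>
      (GaussMinkowski.a μ (k + 2) ^ 2 + GaussMinkowski.b μ (k + 2) ^ 2) /
        (((k + 2 : ℕ) : ℝ) ^ 2 - 1))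
      (-(1 / (2 * Real.pi)) *
        (4 * MeasureTheory.volume.real (GaussMinkowski.region (GaussMinkowski.turning μ)) -
          1 / Real.pi)) := by
    -- The factor turns `-(2/π)` into `1/π²`, the square of the normalisation of `a` and `b`.
    have h := (hΘ.hasSum_volume_region hlt hge).mul_left (-(1 / (2 * Real.pi)))
    refine h.congr_fun fun k => ?_
    rw [GaussMinkowski.a_eq, GaussMinkowski.b_eq]
    field_simp
  refine ⟨GaussMinkowski.region (GaussMinkowski.turning μ), ⟨⟨?_, ?_⟩, ?_⟩, hsum.summable, ?_⟩
  · exact hΘ.memConvOne_region hlt hge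
  · rw [hΘ.boundary_region, hcurve]
  · intro C' hC'
    rw [hC'.eq_convexHull (by rw [hcurve]; exact hΘ.isCompact_range), hcurve,
      GaussMinkowski.region]
  · rw [hsum.tsum_eq]
    field_simp
    ring
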